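/- Call a polygonal chain $P$ in $\mathbb{R}^2$ with vertices $v_1,\dots,v_n$ *$x$-monotone* if the $x$-coordinates of $v_1,\dots,v_n$ are strictly increasing; $P$ is the union of its vertices and of the segments $v_iv_{i+1}$. Let $\mathbb{M}_P$ be the set of points of $\mathbb{R}^2$ that lie on or above $P$, that is, of the points $(x,y)$ with $y\ge y'$ for some $(x,y')\in P$. A point $g\in P$ *sees* a point $p$ if the line segment $gp$ contains no point strictly below $P$ (no point $(x,y)$ with $y<y'$ for some $(x,y')\in P$). A set of points sees $\mathbb{M}_P$ if every point of $\mathbb{M}_P$ is seen by at least one point of the set. **Theorem.** There are an absolute constant $K$, a polynomial $T$, and a deterministic algorithm on the real RAM (exact real arithmetic $+,-,\times,\div$ and comparisons at unit cost, with no rounding; natural-number indices and counters with addition, truncated subtraction and comparison) with the following property. Given the coordinates of the vertices, listed from left to right, of an $x$-monotone polygonal chain $P$ with $n$ vertices and the coordinates of guards $g_1,\dots,g_m\in P$ such that $\mathcal{G}=\{g_1,\dots,g_m\}$ sees $\mathbb{M}_P$, the algorithm halts after at most $T(n+m)$ steps and returns a subset $C\subseteq\mathcal{G}$ that also sees $\mathbb{M}_P$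 and satisfies $|C|\le K\cdot|H|$ for every subset $H\subseteq\mathcal{G}$ that sees $\mathbb{M}_P$. -/

import Mathlib

/-! ### Polygonal chains and visibility in the plane -/

namespace ChainGuard

/-- The polygonal chain with vertices `v 0, …, v (n - 1)`: the union of the vertices and of
the segments joining consecutive vertices. -/
def chain {n : ℕ} (v : Fin n → ℝ × ℝ) : Set (ℝ × ℝ) :=
  Set.range v ∪ {p | ∃ i j : Fin n, (i : ℕ) + 1 = j ∧ p ∈ segment ℝ (v i) (v j)}

/-- The chain is (strictly) `x`-monotone and its vertices are listed from left to right. -/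
def IsXMonotone {n : ℕ} (v : Fin n → ℝ × ℝ) : Prop :=
  StrictMono fun i => (v i).1

/-- The points of the plane that lie on or above the chain. -/
def onOrAbove {n : ℕ} (v : Fin n → ℝ × ℝ) : Set (ℝ × ℝ) :=
  {p | ∃ q ∈ chain v, q.1 = p.1 ∧ q.2 ≤ p.2}

/-- The points of the plane that lie strictly below the chain. -/
def strictlyBelow {n : ℕ} (v : Fin n → ℝ × ℝ) : Set (ℝ × ℝ) :=
  {p | ∃ q ∈ chain v, q.1 = p.1 ∧ p.2 < q.2}

/-- `g` sees `p`: the segment `gp` does not meet the region strictly below the chain. -/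
def Sees {n : ℕ} (v : Fin n → ℝ × ℝ) (g p : ℝ × ℝ) : Prop :=
  Disjoint (segment ℝ g p) (strictlyBelow v)

/-- The visibility polygon of `g`. -/
def vis {n : ℕ} (v : Fin n → ℝ × ℝ) (g : ℝ × ℝ) : Set (ℝ × ℝ) :=
  {p | Sees v g p}

/-- The guards with index in `H` together see every point on or above the chain. -/
def Guards {n m : ℕ} (v : Fin n → ℝ × ℝ) (g : Fin m → ℝ × ℝ) (H : Finset (Fin m)) : Prop :=
  onOrAbove v ⊆ ⋃ j ∈ H, vis v (g j)

end ChainGuard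

/-! ### A real RAM with unit-cost steps

The machine has natural-number and real variables and arrays, each named by a natural number.
A program is a fixed finite text, so it uses finitely many variables and arrays.
Natural numbers, which serve as array indices and counters, can be added, subtracted (truncated
at `0`) and compared.  Real numbers can be added, subtracted, multiplied, divided and compared
exactly; there is no rounding, and no conversion of real numbers to natural numbers. -/

namespace RealRAM

/-- The contents of the memory. -/
structure State where
  /-- natural-number variables -/
  natVar : ℕ → ℕ
  /-- real variables -/
  realVar : ℕ → ℝ
  /-- `natArr a k` is entry `k` of the natural-number array `a` -/
  natArr : ℕ → ℕ → ℕ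
  /-- `realArr a k` is entry `k` of the real array `a` -/
  realArr : ℕ → ℕ → ℝ

/-- The elementary operations.  The first argument of each is the target. -/
inductive Instr where
  /-- `x := c` -/
  | natConst (x c : ℕ)
  /-- `x := y + z` -/
  | natAdd (x y z : ℕ)
  /-- `x := max (y - z) 0` -/
  | natSub (x y z : ℕ)
  /-- `x := a[i]` -/
  | natLoad (x a i : ℕ)
  /-- `a[i] := x` -/
  | natStore (a i x : ℕ)
  /-- `x := c` -/
  | realConst (x : ℕ) (c : ℚ)
  /-- `x := y + z` -/
  | realAdd (x y z : ℕ)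
  /-- `x := y - z` -/
  | realSub (x y z : ℕ)
  /-- `x := y * z` -/
  | realMul (x y z : ℕ)
  /-- `x := y / z`, with value `0` if `z = 0` -/
  | realDiv (x y z : ℕ)
  /-- `x := a[i]`, where the index `i` is a natural-number variable -/
  | realLoad (x a i : ℕ)
  /-- `a[i] := x`, where the index `i` is a natural-number variable -/
  | realStore (a i x : ℕ)

namespace State

/-- Assign a value to a natural-number variable. -/
def setNat (s : State) (x c : ℕ) : State :=
  { s with natVar := Function.update s.natVar x c }

/-- Assign a value to a real variable. -/
def setReal (s : State) (x : ℕ) (c : ℝ) : State :=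
  { s with realVar := Function.update s.realVar x c }

/-- Assign a value to an entry of a natural-number array. -/
def setNatArr (s : State) (a k c : ℕ) : State :=
  { s with natArr := Function.update s.natArr a (Function.update (s.natArr a) k c) }

/-- Assign a value to an entry of a real array. -/
def setRealArr (s : State) (a k : ℕ) (c : ℝ) : State :=
  { s with realArr := Function.update s.realArr a (Function.update (s.realArr a) k c) }

end State

/-- The effect of an elementary operation. -/
noncomputable def Instr.run : Instr → State → State
  | .natConst x c, s => s.setNat x c
  | .natAdd x y z, s => s.setNat x (s.natVar y + s.natVar z)
  | .natSub x y z, s => s.setNat x (s.natVar y - s.natVar z)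
  | .natLoad x a i, s => s.setNat x (s.natArr a (s.natVar i))
  | .natStore a i x, s => s.setNatArr a (s.natVar i) (s.natVar x)
  | .realConst x c, s => s.setReal x (c : ℝ)
  | .realAdd x y z, s => s.setReal x (s.realVar y + s.realVar z)
  | .realSub x y z, s => s.setReal x (s.realVar y - s.realVar z)
  | .realMul x y z, s => s.setReal x (s.realVar y * s.realVar z)
  | .realDiv x y z, s => s.setReal x (s.realVar y / s.realVar z)
  | .realLoad x a i, s => s.setReal x (s.realArr a (s.natVar i))
  | .realStore a i x, s => s.setRealArr a (s.natVar i) (s.realVar x)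

/-- The comparisons that a program can branch on. -/
inductive Cond where
  | natLe (x y : ℕ)
  | natLt (x y : ℕ)
  | realLe (x y : ℕ)
  | realLt (x y : ℕ)

/-- The truth value of a comparison. -/
def Cond.Holds : Cond → State → Prop
  | .natLe x y, s => s.natVar x ≤ s.natVar y
  | .natLt x y, s => s.natVar x < s.natVar y
  | .realLe x y, s => s.realVar x ≤ s.realVar y
  | .realLt x y, s => s.realVar x < s.realVar y

/-- Programs. -/
inductive Prog where
  /-- one elementary operation -/
  | op (i : Instr)
  /-- do nothing -/
  | skip
  /-- first `P`, then `Q` -/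
  | seq (P Q : Prog)
  /-- if `c` then `P` else `Q` -/
  | branch (c : Cond) (P Q : Prog)
  /-- while `c` do `P` -/
  | loop (c : Cond) (P : Prog)

/-- `Exec P s s' t`: started in state `s`, the program `P` halts in state `s'` after exactly
`t` steps; each elementary operation and each evaluation of a comparison is one step. -/
inductive Exec : Prog → State → State → ℕ → Prop
  | op (i : Instr) (s : State) : Exec (.op i) s (i.run s) 1
  | skip (s : State) : Exec .skip s s 0
  | seq {P Q : Prog} {s₁ s₂ s₃ : State} {t u : ℕ} :
      Exec P s₁ s₂ t → Exec Q s₂ s₃ u → Exec (.seq P Q) s₁ s₃ (t + u)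
  | branch_true {c : Cond} {P Q : Prog} {s s' : State} {t : ℕ} :
      c.Holds s → Exec P s s' t → Exec (.branch c P Q) s s' (t + 1)
  | branch_false {c : Cond} {P Q : Prog} {s s' : State} {t : ℕ} :
      ¬ c.Holds s → Exec Q s s' t → Exec (.branch c P Q) s s' (t + 1)
  | loop_true {c : Cond} {P : Prog} {s₁ s₂ s₃ : State} {t u : ℕ} :
      c.Holds s₁ → Exec P s₁ s₂ t → Exec (.loop c P) s₂ s₃ u →
        Exec (.loop c P) s₁ s₃ (t + u + 1)
  | loop_false {c : Cond} {P : Prog} {s : State} :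
      ¬ c.Holds s → Exec (.loop c P) s s 1

end RealRAM

namespace ChainGuard

/-- Entry `k` of a finite list of reals, extended by `0`. -/
def extend {n : ℕ} (f : Fin n → ℝ) (k : ℕ) : ℝ :=
  if h : k < n then f ⟨k, h⟩ else 0

/-- The initial memory for a chain with `n` vertices and for `m` guards.  The first two
natural-number variables hold `n` and `m`, the first four real arrays hold the `x`- and
`y`-coordinates of the vertices and the `x`- and `y`-coordinates of the guards, and
everything else is `0`. -/
def input {n m : ℕ} (v : Fin n → ℝ × ℝ) (g : Fin m → ℝ × ℝ) : RealRAM.State where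
  natVar
    | 0 => n
    | 1 => m
    | _ => 0
  realVar _ := 0
  natArr _ _ := 0
  realArr
    | 0 => extend fun i => (v i).1
    | 1 => extend fun i => (v i).2
    | 2 => extend fun j => (g j).1
    | 3 => extend fun j => (g j).2
    | _ => fun _ => 0

/-- The set of guards returned in a final state: guard `j` is chosen if entry `j` of the
first natural-number array is `1`. -/
def output (m : ℕ) (s : RealRAM.State) : Finset (Fin m) :=
  Finset.univ.filter fun j => s.natArr 0 j = 1

end ChainGuard

/-! The problem is a hitting-set problem, approximated by rounding a fractional solution, and three
facts carry it.

Discretization. The chain is the graph of a piecewise linear function `f`, and a point above the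
chain is seen whenever the chain point under it is seen, so only chain points matter (`guards_iff`).
Visibility between two chain points is decided by the vertices between them
(`clear_iff_belowChord`). While a point moves along an edge, visibility from a fixed guard can
change only at a vertex or where a line through the guard and a vertex meets the line of the edge.
Between two consecutive such critical abscissas all points are therefore equivalent, and it suffices
to see the polynomially many middles of pairs of critical abscissas, a pair of equal ones giving the
critical point itself (`exists_clear_of_middles`). These middles are the targets.

Fractional solution. Repeatedly take the target whose visible guards have the least total weight,
and double the weights of these guards. After `6 * m ^ 2` rounds, `X`, the accumulated normalized
weights, has total `6 * m ^ 2`. If `H` sees all targets, every target has `X`-load at least `6 * m ^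
2 / (2 * |H|)` (`Instance.Weights.le_load`). No linear programming is needed.

Rounding. The guards that see a target lie to its left, at its abscissa, or to its right, and one of
these classes carries a third of its load. Within one class, visibility obeys the order claim: if `a
< b < c < d`, `a` sees `c` and `b` sees `d`, then `a` sees `d` (`BelowChord.cross`). For left
guards, the greedy rule takes the leftmost remaining target and the leftmost guard that sees it. By
the order claim, no guard sees two of the targets taken in this way, so their loads add up to at
most the total of `X` (`Instance.Greedy.card_mul_le`). With `θ` a third of the least load, each
class yields at most `6 * m ^ 2 / θ ≤ 6 * |H|` guards. The three classes together give the factor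
`18`.

The rest is a program logic for the machine, with running times and frame conditions, in which the
program is verified. -/

namespace RealRAM

/-! ### Program logic: frames, timed specifications, loops -/

/-- `Runs P s τ Q`: started in `s`, the program `P` halts after at most `τ` steps in a state that
satisfies `Q`. -/
def Runs (P : Prog) (s : State) (τ : ℕ) (Q : State → Prop) : Prop :=
  ∃ s' t, Exec P s s' t ∧ t ≤ τ ∧ Q s'

/-- The memory location that an instruction may change, as a pair of the kind of the location
(`0`: natural-number variable, `1`: real variable, `2`: natural-number array, `3`: real array)
and its name. -/
def Instr.target : Instr → ℕ × ℕ
  | .natConst x _ => (0, x)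
  | .natAdd x _ _ => (0, x)
  | .natSub x _ _ => (0, x)
  | .natLoad x _ _ => (0, x)
  | .natStore a _ _ => (2, a)
  | .realConst x _ => (1, x)
  | .realAdd x _ _ => (1, x)
  | .realSub x _ _ => (1, x)
  | .realMul x _ _ => (1, x)
  | .realDiv x _ _ => (1, x)
  | .realLoad x _ _ => (1, x)
  | .realStore a _ _ => (3, a)

/-- The program contains no instruction that changes the location `l`. -/
def Prog.avoids (l : ℕ × ℕ) : Prog → Bool
  | .op i => !(Nat.beq i.target.1 l.1 && Nat.beq i.target.2 l.2)
  | .skip => true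
  | .seq P Q => P.avoids l && Q.avoids l
  | .branch _ P Q => P.avoids l && Q.avoids l
  | .loop _ P => P.avoids l

/-- `Prog.avoids` is written with `Nat.beq` so that frame conditions on concrete programs compute to
`true` and are proved by `rfl`. This form serves `simp` when a variable name is a parameter. -/
theorem natBeq_eq_decide (a b : ℕ) : Nat.beq a b = decide (a = b) := by
  rw [Bool.eq_iff_iff]; simp

/-- `s'` agrees with `s` at all locations that `P` avoids. -/
structure Frame (P : Prog) (s s' : State) : Prop where
  nat : ∀ x, P.avoids (0, x) = true → s'.natVar x = s.natVar x
  real : ∀ x, P.avoids (1, x) = true → s'.realVar x = s.realVar x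
  natArr : ∀ a, P.avoids (2, a) = true → s'.natArr a = s.natArr a
  realArr : ∀ a, P.avoids (3, a) = true → s'.realArr a = s.realArr a

theorem Frame.refl (P : Prog) (s : State) : Frame P s s :=
  ⟨fun _ _ => rfl, fun _ _ => rfl, fun _ _ => rfl, fun _ _ => rfl⟩

theorem Frame.comp {P Q R : Prog} {s₁ s₂ s₃ : State} (h₁ : Frame P s₁ s₂) (h₂ : Frame Q s₂ s₃)
    (hP : ∀ l, R.avoids l = true → P.avoids l = true)
    (hQ : ∀ l, R.avoids l = true → Q.avoids l = true) : Frame R s₁ s₃ :=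
  ⟨fun x h => (h₂.nat x (hQ _ h)).trans (h₁.nat x (hP _ h)),
   fun x h => (h₂.real x (hQ _ h)).trans (h₁.real x (hP _ h)),
   fun x h => (h₂.natArr x (hQ _ h)).trans (h₁.natArr x (hP _ h)),
   fun x h => (h₂.realArr x (hQ _ h)).trans (h₁.realArr x (hP _ h))⟩

theorem Frame.trans {P : Prog} {s₁ s₂ s₃ : State} (h₁ : Frame P s₁ s₂) (h₂ : Frame P s₂ s₃) :
    Frame P s₁ s₃ := h₁.comp h₂ (fun _ => id) (fun _ => id)

theorem Frame.mono {P R : Prog} {s₁ s₂ : State} (h₁ : Frame P s₁ s₂)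
    (hP : ∀ l, R.avoids l = true → P.avoids l = true) : Frame R s₁ s₂ :=
  h₁.comp (Frame.refl P _) hP hP

theorem Instr.frame (i : Instr) (s : State) : Frame (.op i) s (i.run s) := by
  constructor <;> intro x h <;> cases i <;>
    first
    | rfl
    | (refine Function.update_of_ne ?_ _ _; rintro rfl; simp [Prog.avoids, Instr.target] at h)

/-- Since the targets of instructions are fixed names in the program text, a syntactic check shows
what an execution preserves. Specifications can then mention only what changes; `Runs.seq` and
`Runs.conseq` pass the frame along. -/
theorem Exec.frame {P : Prog} {s s' : State} {t : ℕ} (h : Exec P s s' t) : Frame P s s' := by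
  induction h with
  | op i s => exact i.frame s
  | skip s => exact Frame.refl _ _
  | seq _ _ h₁ h₂ =>
    exact h₁.comp h₂ (fun l h => by simp_all [Prog.avoids]) (fun l h => by simp_all [Prog.avoids])
  | branch_true _ _ h₁ => exact h₁.mono (fun l h => by simp_all [Prog.avoids])
  | branch_false _ _ h₁ => exact h₁.mono (fun l h => by simp_all [Prog.avoids])
  | loop_true _ _ _ h₁ h₂ => exact h₁.comp h₂ (fun l h => h) (fun l h => h)
  | loop_false _ => exact Frame.refl _ _

variable {P Q : Prog} {s : State} {τ υ : ℕ} {A B : State → Prop}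

theorem Runs.mono (h : Runs P s τ A) (hτ : τ ≤ υ) (hAB : ∀ s', Frame P s s' → A s' → B s') :
    Runs P s υ B := by
  obtain ⟨s', t, he, ht, ha⟩ := h
  exact ⟨s', t, he, ht.trans hτ, hAB s' he.frame ha⟩

theorem Runs.conseq (h : Runs P s τ A) (hAB : ∀ s', Frame P s s' → A s' → B s') :
    Runs P s τ B := h.mono le_rfl hAB

theorem runs_op (i : Instr) (h : A (i.run s)) : Runs (.op i) s 1 A :=
  ⟨_, _, .op i s, le_rfl, h⟩

theorem runs_skip (h : A s) : Runs .skip s 0 A := ⟨_, _, .skip s, le_rfl, h⟩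

theorem Runs.seq (hP : Runs P s τ A) (hQ : ∀ s', Frame P s s' → A s' → Runs Q s' υ B) :
    Runs (.seq P Q) s (τ + υ) B := by
  obtain ⟨s₁, t₁, he₁, ht₁, ha⟩ := hP
  obtain ⟨s₂, t₂, he₂, ht₂, hb⟩ := hQ s₁ he₁.frame ha
  exact ⟨s₂, _, .seq he₁ he₂, by omega, hb⟩

theorem runs_branch {c : Cond} (h₁ : c.Holds s → Runs P s τ A) (h₂ : ¬ c.Holds s → Runs Q s τ A) :
    Runs (.branch c P Q) s (τ + 1) A := by
  by_cases hc : c.Holds s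
  · obtain ⟨s', t, he, ht, ha⟩ := h₁ hc
    exact ⟨s', _, .branch_true hc he, by omega, ha⟩
  · obtain ⟨s', t, he, ht, ha⟩ := h₂ hc
    exact ⟨s', _, .branch_false hc he, by omega, ha⟩

/-- Straight-line code. -/
def ops : List Instr → Prog
  | [] => .skip
  | i :: l => .seq (.op i) (ops l)

/-- The effect of straight-line code. -/
noncomputable def runOps : List Instr → State → State
  | [], s => s
  | i :: l, s => runOps l (i.run s)

theorem runs_ops (l : List Instr) (h : A (runOps l s)) : Runs (ops l) s l.length A := by
  induction l generalizing s with
  | nil => exact runs_skip h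
  | cons i l ih =>
    have := (runs_op (A := fun s' => s' = i.run s) i rfl).seq (Q := ops l) (υ := l.length) (B := A)
      (by rintro s' - rfl; exact ih h)
    exact this.mono (by simp; omega) (fun _ _ h => h)

/-- `for i = 0, …, lim - 1 do body`; the natural-number variable `2` has to hold `1`. -/
def forP (i lim : ℕ) (body : Prog) : Prog :=
  .seq (.op (.natConst i 0)) (.loop (.natLt i lim) (.seq body (.op (.natAdd i i 2))))

/-- The running time of a loop with `B` rounds of `τ` steps. -/
def forT {R : Type*} [CommSemiring R] (B τ : R) : R := B * (τ + 2) + 2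

/-- Induction on the number of rounds left. The invariant `I k` refers to the state in which the
counter already holds `k`, hence the `setNat` in `hstep`. The frame handed to `hstep` is that of the
whole loop relative to its start, so facts about untouched locations need not be put into `I`. Time
is charged for `N` rounds rather than `L`, so that one polynomial bound serves every loop. -/
theorem runs_for {i lim L N : ℕ} {body : Prog} (I : ℕ → State → Prop)
    (hL : s.natVar lim = L) (hN : L ≤ N) (h1 : s.natVar 2 = 1)
    (hw : (body.avoids (0, i) && body.avoids (0, lim) && body.avoids (0, 2) &&
      decide (i ≠ lim) && decide (i ≠ 2)) = true)
    (h0 : I 0 (s.setNat i 0))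
    (hstep : ∀ k < L, ∀ s', Frame (forP i lim body) s s' → s'.natVar i = k → I k s' →
      Runs body s' τ (fun s'' => I (k + 1) (s''.setNat i (k + 1)))) :
    Runs (forP i lim body) s (forT N τ) (I L) := by
  simp only [Bool.and_eq_true, decide_eq_true_eq] at hw
  obtain ⟨⟨⟨⟨hbi, hbl⟩, hb2⟩, hil⟩, hi2⟩ := hw
  have hrun : ∀ r k s', r + k = L → Frame (forP i lim body) s s' → s'.natVar i = k → I k s' →
      s'.natVar lim = L → s'.natVar 2 = 1 →
      Runs (.loop (.natLt i lim) (.seq body (.op (.natAdd i i 2)))) s' (r * (τ + 2) + 1) (I L) := by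
    intro r
    induction r with
    | zero =>
      intro k s' hk hF hi hI hl h2
      have : k = L := by omega
      subst this
      exact ⟨s', 1, .loop_false (by simp [Cond.Holds, hi, hl]), by omega, hI⟩
    | succ r ih =>
      intro k s' hk hF hi hI hl h2
      obtain ⟨s₁, t₁, he₁, ht₁, hI₁⟩ := hstep k (by omega) s' hF hi hI
      have hF₁ := he₁.frame
      have hi₁ : s₁.natVar i = k := by rw [hF₁.nat i hbi, hi]
      have hl₁ : s₁.natVar lim = L := by rw [hF₁.nat lim hbl, hl]
      have h2₁ : s₁.natVar 2 = 1 := by rw [hF₁.nat 2 hb2, h2]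
      have hrun₁ : (Instr.natAdd i i 2).run s₁ = s₁.setNat i (k + 1) := by
        simp [Instr.run, hi₁, h2₁]
      have he₂ := Exec.seq he₁ (Exec.op (.natAdd i i 2) s₁)
      have hF₂ := he₂.frame
      rw [hrun₁] at he₂ hF₂
      obtain ⟨s₃, t₃, he₃, ht₃, hI₃⟩ := ih (k + 1) _ (by omega)
        (hF.trans (hF₂.mono (fun l h => by simp_all [Prog.avoids, forP])))
        (by simp [State.setNat]) hI₁
        (by simp [State.setNat, Function.update_of_ne (Ne.symm hil), hl₁])
        (by simp [State.setNat, Function.update_of_ne (Ne.symm hi2), h2₁])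
      refine ⟨s₃, _, .loop_true (by simp [Cond.Holds, hi, hl]; omega) he₂ he₃, ?_, hI₃⟩
      rw [Nat.succ_mul]; omega
  have h := (runs_op (A := fun s' => s' = s.setNat i 0) (.natConst i 0) rfl).seq
    (Q := .loop (.natLt i lim) (.seq body (.op (.natAdd i i 2)))) (υ := L * (τ + 2) + 1) (B := I L) (by
      rintro s' hF rfl
      exact hrun L 0 _ (by omega) (hF.mono (fun l h => by simp_all [Prog.avoids, forP]))
        (by simp [State.setNat]) h0
        (by simp [State.setNat, Function.update_of_ne (Ne.symm hil), hL])
        (by simp [State.setNat, Function.update_of_ne (Ne.symm hi2), h1]))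
  refine h.mono ?_ (fun _ _ h => h)
  have := Nat.mul_le_mul_right (τ + 2) hN
  simp only [forT]; omega

end RealRAM

namespace RealRAM

attribute [local simp] runOps Instr.run State.setNat State.setReal State.setNatArr State.setRealArr
  Function.update_apply Cond.Holds

variable {s : State} {τ : ℕ}

/-! ### Searching for a least key -/

/-- Search for the least key: `K` decides whether the index `lv` is eligible (natural-number
variable `34`) and computes its key (real variable `24`).  The result is natural-number variable
`30`, if variable `31` is positive, and the least key is real variable `22`. -/
def argminP (K : Prog) (lv lim : ℕ) : Prog :=
  .seq (.op (.natConst 31 0)) (forP lv lim (.seq K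
    (.branch (.natLt 3 34)
      (.branch (.natLt 3 31)
        (.branch (.realLt 24 22)
          -- Real variable `20` and natural-number variable `3` hold zero throughout, so adding them
          -- is the machine's way to copy a variable.
          (ops [.realAdd 22 24 20, .natAdd 30 lv 3, .natConst 31 1]) .skip)
        (ops [.realAdd 22 24 20, .natAdd 30 lv 3, .natConst 31 1]))
      .skip)))

/-- The running time of a search for the least key. -/
def argminT {R : Type*} [CommSemiring R] (B τ : R) : R := 1 + forT B (τ + 6)

/-- `p` is an eligible index below `L` of least key, or, if `f = 0`, there is none. -/
def IsArgmin (E : ℕ → Prop) (κ : ℕ → ℝ) (L f p : ℕ) (b : ℝ) : Prop :=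
  (f = 0 ∧ ∀ k < L, ¬ E k) ∨ (f = 1 ∧ p < L ∧ E p ∧ b = κ p ∧ ∀ k < L, E k → κ p ≤ κ k)

theorem IsArgmin.succ_of_not {E : ℕ → Prop} {κ : ℕ → ℝ} {L f p : ℕ} {b : ℝ}
    (h : IsArgmin E κ L f p b) (hL : ¬ E L) : IsArgmin E κ (L + 1) f p b := by
  rcases h with ⟨h, h'⟩ | ⟨h, hp, he, hb, h'⟩
  · refine Or.inl ⟨h, fun k hk => ?_⟩
    rcases Nat.lt_succ_iff_lt_or_eq.1 hk with hk | rfl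
    exacts [h' k hk, hL]
  · refine Or.inr ⟨h, by omega, he, hb, fun k hk hek => ?_⟩
    rcases Nat.lt_succ_iff_lt_or_eq.1 hk with hk | rfl
    exacts [h' k hk hek, (hL hek).elim]

theorem IsArgmin.succ_of_le {E : ℕ → Prop} {κ : ℕ → ℝ} {L f p : ℕ} {b : ℝ}
    (h : IsArgmin E κ L f p b) (hf : 0 < f) (hL : b ≤ κ L) : IsArgmin E κ (L + 1) f p b := by
  rcases h with ⟨h, h'⟩ | ⟨h, hp, he, hb, h'⟩
  · omega
  · refine Or.inr ⟨h, by omega, he, hb, fun k hk hek => ?_⟩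
    rcases Nat.lt_succ_iff_lt_or_eq.1 hk with hk | rfl
    exacts [h' k hk hek, hb ▸ hL]

theorem IsArgmin.succ_new {E : ℕ → Prop} {κ : ℕ → ℝ} {L f p : ℕ} {b : ℝ}
    (h : IsArgmin E κ L f p b) (hL : E L) (hf : 0 < f → κ L < b) :
    IsArgmin E κ (L + 1) 1 L (κ L) := by
  refine Or.inr ⟨rfl, by omega, hL, rfl, fun k hk hek => ?_⟩
  rcases Nat.lt_succ_iff_lt_or_eq.1 hk with hk | rfl
  · rcases h with ⟨h, h'⟩ | ⟨h, hp, he, hb, h'⟩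
    · exact (h' k hk hek).elim
    · have := hf (by omega)
      exact (hb ▸ this).le.trans (h' k hk hek)
  · exact le_rfl

theorem runs_argmin {K : Prog} {lv lim L N : ℕ} (E : ℕ → Prop) (κ : ℕ → ℝ)
    (hL : s.natVar lim = L) (hN : L ≤ N) (h2 : s.natVar 2 = 1) (h3 : s.natVar 3 = 0)
    (hz : s.realVar 20 = 0)
    (hw : (K.avoids (0, lv) && K.avoids (0, lim) && K.avoids (0, 2) && K.avoids (0, 3) &&
      K.avoids (0, 30) && K.avoids (0, 31) && K.avoids (1, 20) && K.avoids (1, 22) &&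
      decide (lv ≠ lim) && decide (lv ≠ 2) && decide (lv ≠ 3) && decide (lv < 30) &&
      decide (lim < 30)) = true)
    (hK : ∀ k < L, ∀ s', Frame (argminP K lv lim) s s' → s'.natVar lv = k →
      Runs K s' τ (fun s'' => (0 < s''.natVar 34 ↔ E k) ∧ (E k → s''.realVar 24 = κ k))) :
    Runs (argminP K lv lim) s (argminT N τ)
      (fun s' => IsArgmin E κ L (s'.natVar 31) (s'.natVar 30) (s'.realVar 22)) := by
  simp only [Bool.and_eq_true, decide_eq_true_eq] at hw
  obtain ⟨⟨⟨⟨⟨⟨⟨⟨⟨⟨⟨⟨ha1, ha2⟩, ha3⟩, ha4⟩, ha5⟩, ha6⟩, ha7⟩, ha8⟩, hne⟩, hlv2⟩, hlv3⟩, hlv⟩, hlim⟩ := hw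
  have e1 : lv ≠ 30 := by omega
  have e2 : lv ≠ 31 := by omega
  have e3 : lim ≠ 30 := by omega
  have e4 : lim ≠ 31 := by omega
  refine (runs_op (A := fun s' => s' = s.setNat 31 0) (.natConst 31 0) rfl).seq ?_
  rintro _ hF rfl
  refine runs_for (fun k s' => IsArgmin E κ k (s'.natVar 31) (s'.natVar 30) (s'.realVar 22))
    (L := L) (by simp [e4, hL]) hN (by simp [h2]) ?_ ?_ ?_
  · simp [Prog.avoids, ops, Instr.target, natBeq_eq_decide, ha1, ha2, ha3, hne, hlv2, e1.symm, e2.symm, e3.symm,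
      e4.symm]
  · exact Or.inl ⟨by simp [e2.symm], fun k hk => by omega⟩
  · intro k hk s' hF' hi hI
    have hFs : Frame (argminP K lv lim) s s' := hF.comp hF'
      (fun l h => by simp only [argminP, Prog.avoids, Bool.and_eq_true] at h ⊢; exact h.1)
      (fun l h => by
        simp only [argminP, Prog.avoids, Bool.and_eq_true] at h; exact h.2)
    have e33 : s'.natVar 3 = 0 := by
      rw [hF'.nat 3 (by
        simp [forP, Prog.avoids, ops, Instr.target, natBeq_eq_decide, ha4, hlv3])]
      simp [h3]
    have e20 : s'.realVar 20 = 0 := by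
      rw [hF'.real 20 (by simp [forP, Prog.avoids, ops, Instr.target, natBeq_eq_decide, ha7])]
      simp [hz]
    refine ((hK k hk s' hFs hi).seq (υ := 6) (B := fun s'' =>
      IsArgmin E κ (k + 1) (s''.natVar 31) (s''.natVar 30) (s''.realVar 22)) ?_).conseq ?_
    · intro s₁ hF₁ ⟨hE, hκ⟩
      have f31 := hF₁.nat 31 ha6
      have f30 := hF₁.nat 30 ha5
      have f3 := hF₁.nat 3 ha4
      have flv := hF₁.nat lv ha1
      have f22 := hF₁.real 22 ha8
      have f20 := hF₁.real 20 ha7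
      rw [← f31, ← f30, ← f22] at hI
      refine runs_branch (τ := 5) (fun hc => ?_) (fun hc => ?_)
      · replace hc : E k := hE.1 (by simpa [f3, e33] using hc)
        refine runs_branch (τ := 4) (fun hc' => ?_) (fun hc' => ?_)
        · replace hc' : 0 < s₁.natVar 31 := by simpa [f3, e33] using hc'
          refine runs_branch (τ := 3) (fun hd => ?_) (fun hd => ?_)
          · simp only [Cond.Holds, hκ hc] at hd
            refine runs_ops _ ?_
            have := hI.succ_new hc (fun _ => hd)
            simpa [hκ hc, f20, e20, f3, e33, flv, hi] using this
          · simp only [Cond.Holds, hκ hc, not_lt] at hd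
            exact (runs_skip (hI.succ_of_le hc' hd)).mono (by omega) (fun _ _ h => h)
        · replace hc' : ¬ 0 < s₁.natVar 31 := by simpa [f3, e33] using hc'
          refine (runs_ops _ ?_).mono (υ := 4) (by simp) (fun _ _ h => h)
          have := hI.succ_new hc (fun h => (hc' h).elim)
          simpa [hκ hc, f20, e20, f3, e33, flv, hi] using this
      · replace hc : ¬ E k := fun h => hc (by simpa [f3, e33] using hE.2 h)
        exact (runs_skip (hI.succ_of_not hc)).mono (by omega) (fun _ _ h => h)
    · intro s'' _ h
      simpa [e1.symm, e2.symm] using h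

/-! ### Discrete instances and the visibility test -/

/-- A chain with vertices `(vx i, vy i)`, `i < n`, guards `(gx j, gy j)`, `j < m`, and targets
`(tx t, ty t)`, `t < M`. -/
structure Instance where
  n : ℕ
  m : ℕ
  M : ℕ
  vx : ℕ → ℝ
  vy : ℕ → ℝ
  gx : ℕ → ℝ
  gy : ℕ → ℝ
  tx : ℕ → ℝ
  ty : ℕ → ℝ

/-- `D` is stored in the memory, together with some constants. -/
structure Env (D : Instance) (s : State) : Prop where
  n : s.natVar 0 = D.n
  m : s.natVar 1 = D.m
  one : s.natVar 2 = 1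
  zero : s.natVar 3 = 0
  M : s.natVar 4 = D.M
  rzero : s.realVar 20 = 0
  vx : s.realArr 0 = D.vx
  vy : s.realArr 1 = D.vy
  gx : s.realArr 2 = D.gx
  gy : s.realArr 3 = D.gy
  tx : s.realArr 4 = D.tx
  ty : s.realArr 5 = D.ty

/-- The program changes none of the locations that hold the instance. -/
def Prog.avoidsEnv (P : Prog) : Bool :=
  P.avoids (0, 0) && P.avoids (0, 1) && P.avoids (0, 2) && P.avoids (0, 3) && P.avoids (0, 4) &&
  P.avoids (1, 20) && P.avoids (3, 0) && P.avoids (3, 1) && P.avoids (3, 2) && P.avoids (3, 3) &&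
  P.avoids (3, 4) && P.avoids (3, 5)

theorem Env.of_frame {D : Instance} {P : Prog} (h : Env D s) (hF : Frame P s s')
    (hP : P.avoidsEnv = true) : Env D s' := by
  simp only [Prog.avoidsEnv, Bool.and_eq_true] at hP
  obtain ⟨⟨⟨⟨⟨⟨⟨⟨⟨⟨⟨h0, h1⟩, h2⟩, h3⟩, h4⟩, h5⟩, h6⟩, h7⟩, h8⟩, h9⟩, h10⟩, h11⟩ := hP
  exact ⟨(hF.nat _ h0).trans h.n, (hF.nat _ h1).trans h.m, (hF.nat _ h2).trans h.one,
    (hF.nat _ h3).trans h.zero, (hF.nat _ h4).trans h.M, (hF.real _ h5).trans h.rzero,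
    (hF.realArr _ h6).trans h.vx, (hF.realArr _ h7).trans h.vy, (hF.realArr _ h8).trans h.gx,
    (hF.realArr _ h9).trans h.gy, (hF.realArr _ h10).trans h.tx, (hF.realArr _ h11).trans h.ty⟩

/-- The sign of this number tells on which side of the line through guard `j` and target `t`
vertex `i` lies. -/
def Instance.cross (D : Instance) (j t i : ℕ) : ℝ :=
  (D.ty t - D.gy j) * (D.vx i - D.gx j) - (D.vy i - D.gy j) * (D.tx t - D.gx j)

/-- Vertex `i` hides target `t` from guard `j`. -/
def Instance.Hides (D : Instance) (j t i : ℕ) : Prop :=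
  (D.gx j < D.vx i ∧ D.vx i < D.tx t ∧ D.cross j t i < 0) ∨
  (D.tx t < D.vx i ∧ D.vx i < D.gx j ∧ 0 < D.cross j t i)

/-- No vertex hides target `t` from guard `j`. -/
def Instance.Unobstructed (D : Instance) (j t : ℕ) : Prop := ∀ i < D.n, ¬ D.Hides j t i

/-- The component of `c` that belongs to guards at `a` and targets at `b`. -/
noncomputable def side (c : ℕ × ℕ × ℕ) (a b : ℝ) : ℕ :=
  if a < b then c.1 else if b < a then c.2.2 else c.2.1

/-- Guard `j` sees target `t`, and is in a position relative to `t` that `c` allows. -/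
def Instance.Rel (D : Instance) (c : ℕ × ℕ × ℕ) (j t : ℕ) : Prop :=
  0 < side c (D.gx j) (D.tx t) ∧ D.Unobstructed j t

/-- The allowed relative positions, which are stored in three variables. -/
def State.cls (s : State) : ℕ × ℕ × ℕ := (s.natVar 20, s.natVar 21, s.natVar 22)

/-- Decide whether guard `10` sees target `11`, and store the answer in variable `13`. -/
def seesP : Prog :=
  .seq (ops [.realLoad 0 2 10, .realLoad 1 3 10, .realLoad 2 4 11, .realLoad 3 5 11])
  -- The answer starts as the class component for the relative position of guard and target, and any
  -- hiding vertex resets it to zero. One routine thus tests visibility within any class.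
  (.seq (.branch (.realLt 0 2) (.op (.natAdd 13 20 3))
    (.branch (.realLt 2 0) (.op (.natAdd 13 22 3)) (.op (.natAdd 13 21 3))))
  (forP 12 0 (.seq (ops [.realLoad 4 0 12, .realLoad 5 1 12, .realSub 6 3 1, .realSub 7 4 0,
      .realMul 6 6 7, .realSub 7 5 1, .realSub 8 2 0, .realMul 7 7 8, .realSub 6 6 7])
    (.branch (.realLt 0 4)
      (.branch (.realLt 4 2) (.branch (.realLt 6 20) (.op (.natConst 13 0)) .skip) .skip)
      (.branch (.realLt 2 4)
        (.branch (.realLt 4 0) (.branch (.realLt 20 6) (.op (.natConst 13 0)) .skip) .skip)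
        .skip)))))

/-- The running time of the visibility test. -/
def seesT {R : Type*} [CommSemiring R] (B : R) : R := 4 + (3 + forT B 14)

theorem runs_sees {D : Instance} {N : ℕ} (h : Env D s) (hN : D.n ≤ N) :
    Runs seesP s (seesT N)
      (fun s' => 0 < s'.natVar 13 ↔ D.Rel s.cls (s.natVar 10) (s.natVar 11)) := by
  refine (runs_ops (A := fun s' => s'.realVar 0 = D.gx (s.natVar 10) ∧
    s'.realVar 1 = D.gy (s.natVar 10) ∧ s'.realVar 2 = D.tx (s.natVar 11) ∧
    s'.realVar 3 = D.ty (s.natVar 11)) _ (by simp [h.gx, h.gy, h.tx, h.ty])).seq ?_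
  intro s₁ hF₁ ⟨h10, h11, h12, h13⟩
  have hE₁ := h.of_frame hF₁ rfl
  have hc0 := hF₁.nat 20 rfl
  have hc1 := hF₁.nat 21 rfl
  have hc2 := hF₁.nat 22 rfl
  refine Runs.seq (τ := 3) (A := fun s' => s'.natVar 13 =
    side s.cls (D.gx (s.natVar 10)) (D.tx (s.natVar 11))) ?_ ?_
  · refine runs_branch (τ := 2) (fun hc => ?_) (fun hc => ?_)
    · refine (runs_op _ ?_).mono (υ := 2) (by simp) (fun _ _ h => h)
      have hc' : D.gx (s.natVar 10) < D.tx (s.natVar 11) := by simpa [h10, h12] using hc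
      simp [side, hc', hE₁.zero, hc0, State.cls]
    · have hc' : ¬ D.gx (s.natVar 10) < D.tx (s.natVar 11) := by simpa [h10, h12] using hc
      refine runs_branch (τ := 1) (fun hd => ?_) (fun hd => ?_)
      · refine (runs_op _ ?_)
        have hd' : D.tx (s.natVar 11) < D.gx (s.natVar 10) := by simpa [h10, h12] using hd
        simp [side, hc', hd', hE₁.zero, hc2, State.cls]
      · refine (runs_op _ ?_)
        have hd' : ¬ D.tx (s.natVar 11) < D.gx (s.natVar 10) := by simpa [h10, h12] using hd
        simp [side, hc', hd', hE₁.zero, hc1, State.cls]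
  intro s₂ hF₂ hs
  have hE₂ := hE₁.of_frame hF₂ rfl
  have h20 := (hF₂.real 0 rfl).trans h10
  have h21 := (hF₂.real 1 rfl).trans h11
  have h22 := (hF₂.real 2 rfl).trans h12
  have h23 := (hF₂.real 3 rfl).trans h13
  refine (runs_for (L := D.n) (fun k s' => 0 < s'.natVar 13 ↔
    0 < side s.cls (D.gx (s.natVar 10)) (D.tx (s.natVar 11)) ∧
      ∀ i < k, ¬ D.Hides (s.natVar 10) (s.natVar 11) i) hE₂.n hN hE₂.one rfl (by simp [hs]) ?_)
  intro k hk s₃ hF₃ hi hI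
  have hE₃ := hE₂.of_frame hF₃ rfl
  have h30 := (hF₃.real 0 rfl).trans h20
  have h31 := (hF₃.real 1 rfl).trans h21
  have h32 := (hF₃.real 2 rfl).trans h22
  have h33 := (hF₃.real 3 rfl).trans h23
  refine Runs.seq (τ := 9) (υ := 5) (runs_ops (A := fun s' => s'.realVar 4 = D.vx k ∧
    s'.realVar 6 = D.cross (s.natVar 10) (s.natVar 11) k) _
    (by simp [hE₃.vx, hE₃.vy, hi, h30, h31, h32, h33, Instance.cross])) ?_
  intro s₄ hF₄ ⟨h44, h46⟩
  have h40 := (hF₄.real 0 rfl).trans h30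
  have h42 := (hF₄.real 2 rfl).trans h32
  have h4z := (hF₄.real 20 rfl).trans hE₃.rzero
  rw [← hF₄.nat 13 rfl] at hI
  have key0 : D.Hides (s.natVar 10) (s.natVar 11) k →
      (0 < 0 ↔ 0 < side s.cls (D.gx (s.natVar 10)) (D.tx (s.natVar 11)) ∧
      ∀ i < k + 1, ¬ D.Hides (s.natVar 10) (s.natVar 11) i) := fun hH =>
    ⟨fun h => (lt_irrefl _ h).elim, fun h => (h.2 k (by omega) hH).elim⟩
  have key1 : ¬ D.Hides (s.natVar 10) (s.natVar 11) k →
      (0 < s₄.natVar 13 ↔ 0 < side s.cls (D.gx (s.natVar 10)) (D.tx (s.natVar 11)) ∧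
      ∀ i < k + 1, ¬ D.Hides (s.natVar 10) (s.natVar 11) i) := fun hH => by
    rw [hI]
    refine and_congr_right fun _ => ⟨fun h i hi => ?_, fun h i hi => h i (by omega)⟩
    rcases Nat.lt_succ_iff_lt_or_eq.1 hi with hi | rfl
    exacts [h i hi, hH]
  refine runs_branch (τ := 4) (fun hc => ?_) (fun hc => ?_) <;>
    simp only [Cond.Holds, h40, h44] at hc
  · refine (runs_branch (τ := 2) (fun hc1 => ?_) (fun hc1 => ?_)).mono (υ := 4) (by omega)
      (fun _ _ h => h) <;> simp only [Cond.Holds, h42, h44] at hc1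
    · refine runs_branch (τ := 1) (fun hc2 => ?_) (fun hc2 => ?_) <;>
        simp only [Cond.Holds, h46, h4z] at hc2
      · refine runs_op _ ?_
        simpa using key0 (Or.inl ⟨hc, hc1, hc2⟩)
      · refine (runs_skip ?_).mono (υ := 1) (by omega) (fun _ _ h => h)
        simpa using key1 (by rintro (⟨-, -, h⟩ | ⟨-, h, -⟩); exacts [hc2 h, lt_asymm hc h])
    · refine (runs_skip ?_).mono (by omega) (fun _ _ h => h)
      simpa using key1 (by rintro (⟨-, h, -⟩ | ⟨-, h, -⟩); exacts [hc1 h, lt_asymm hc h])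
  · refine runs_branch (τ := 3) (fun hc1 => ?_) (fun hc1 => ?_) <;>
      simp only [Cond.Holds, h42, h44] at hc1
    · refine runs_branch (τ := 2) (fun hc2 => ?_) (fun hc2 => ?_) <;>
        simp only [Cond.Holds, h40, h44] at hc2
      · refine runs_branch (τ := 1) (fun hc3 => ?_) (fun hc3 => ?_) <;>
          simp only [Cond.Holds, h46, h4z] at hc3
        · refine runs_op _ ?_
          simpa using key0 (Or.inr ⟨hc1, hc2, hc3⟩)
        · refine (runs_skip ?_).mono (υ := 1) (by omega) (fun _ _ h => h)
          simpa using key1 (by rintro (⟨h, -, -⟩ | ⟨-, -, h⟩); exacts [hc h, hc3 h])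
      · refine (runs_skip ?_).mono (by omega) (fun _ _ h => h)
        simpa using key1 (by rintro (⟨h, -, -⟩ | ⟨-, h, -⟩); exacts [hc h, hc2 h])
    · refine (runs_skip ?_).mono (by omega) (fun _ _ h => h)
      simpa using key1 (by rintro (⟨h, -, -⟩ | ⟨h, -, -⟩); exacts [hc h, hc1 h])

/-! ### Loads of targets -/

open Classical in
/-- The total value of the guards that see target `t`. -/
noncomputable def Instance.load (D : Instance) (c : ℕ × ℕ × ℕ) (f : ℕ → ℝ) (t : ℕ) : ℝ :=
  ∑ j ∈ Finset.range D.m, if D.Rel c j t then f j else 0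

/-- Sum the entries of the real array `a` that belong to guards that see target `11`. -/
def loadP (a : ℕ) : Prog :=
  .seq (.op (.realConst 24 0)) (forP 10 1 (.seq seesP (.branch (.natLt 3 13)
    (ops [.realLoad 0 a 10, .realAdd 24 24 0]) .skip)))

/-- The running time of `loadP`. -/
def loadT {R : Type*} [CommSemiring R] (B : R) : R := 1 + forT B (seesT B + 3)

theorem runs_load {D : Instance} {N a : ℕ} (h : Env D s) (hN : D.n ≤ N) (hm : D.m ≤ N) :
    Runs (loadP a) s (loadT N)
      (fun s' => s'.realVar 24 = D.load s.cls (s.realArr a) (s.natVar 11)) := by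
  classical
  refine (runs_op (A := fun s' => s'.realVar 24 = 0) _ (by simp)).seq ?_
  intro s₁ hF₁ h24
  have hE₁ := h.of_frame hF₁ rfl
  refine (runs_for (L := D.m) (fun k s' => s'.realVar 24 = ∑ j ∈ Finset.range k,
    if D.Rel s.cls j (s.natVar 11) then s.realArr a j else 0) hE₁.m hm hE₁.one rfl
    (by simp [h24]) ?_)
  intro k hk s₂ hF₂ hi hI
  have hE₂ := hE₁.of_frame hF₂ rfl
  have h11 := (hF₂.nat 11 rfl).trans (hF₁.nat 11 rfl)
  have h20 := (hF₂.nat 20 rfl).trans (hF₁.nat 20 rfl)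
  have h21 := (hF₂.nat 21 rfl).trans (hF₁.nat 21 rfl)
  have h22 := (hF₂.nat 22 rfl).trans (hF₁.nat 22 rfl)
  have ha := (hF₂.realArr a rfl).trans (hF₁.realArr a rfl)
  have hcls : s₂.cls = s.cls := by simp [State.cls, h20, h21, h22]
  refine (runs_sees hE₂ hN).seq ?_
  intro s₃ hF₃ hs
  have hE₃ := hE₂.of_frame hF₃ rfl
  rw [hcls, hi, h11] at hs
  rw [← hF₃.real 24 rfl] at hI
  refine runs_branch (τ := 2) (fun hc => ?_) (fun hc => ?_) <;>
    simp only [Cond.Holds, hE₃.zero, hs] at hc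
  · refine runs_ops _ ?_
    simp [Finset.sum_range_succ, hc, hI, hF₃.realArr a rfl, ha, hF₃.nat 10 rfl, hi]
  · refine (runs_skip ?_).mono (by omega) (fun _ _ h => h)
    simp [Finset.sum_range_succ, hc, hI]

/-- Guard `j` sees target `t`, whatever their relative position. -/
theorem Instance.rel_all {D : Instance} {j t : ℕ} :
    D.Rel (1, 1, 1) j t ↔ D.Unobstructed j t := by
  simp [Instance.Rel, side]

theorem Instance.load_congr {D : Instance} {c : ℕ × ℕ × ℕ} {f f' : ℕ → ℝ} {t : ℕ}
    (h : ∀ j < D.m, f j = f' j) : D.load c f t = D.load c f' t := by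
  refine Finset.sum_congr rfl fun j hj => ?_
  rw [h j (Finset.mem_range.1 hj)]

theorem Instance.load_add {D : Instance} {c : ℕ × ℕ × ℕ} {f f' : ℕ → ℝ} {t : ℕ} :
    D.load c (fun j => f j + f' j) t = D.load c f t + D.load c f' t := by
  rw [Instance.load, Instance.load, Instance.load, ← Finset.sum_add_distrib]
  refine Finset.sum_congr rfl fun j hj => ?_
  split_ifs <;> simp

theorem Instance.load_div {D : Instance} {c : ℕ × ℕ × ℕ} {f : ℕ → ℝ} {r : ℝ} {t : ℕ} :
    D.load c (fun j => f j / r) t = D.load c f t / r := by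
  rw [Instance.load, Instance.load, Finset.sum_div]
  refine Finset.sum_congr rfl fun j hj => ?_
  split_ifs <;> simp

/-! ### Multiplicative weights: a fractional solution -/

/-- The guards in `H` see all targets. -/
def Instance.Hits (D : Instance) (H : Finset ℕ) : Prop :=
  H ⊆ Finset.range D.m ∧ ∀ t < D.M, ∃ j ∈ H, D.Unobstructed j t

/-- What holds after `i` rounds of the multiplicative-weights algorithm, with weights `w` of
sum `S`, and with `X` the sum of the normalized weights over all rounds. -/
structure Instance.Weights (D : Instance) (i : ℕ) (w X : ℕ → ℝ) (S : ℝ) : Prop where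
  one_le : ∀ j < D.m, 1 ≤ w j
  sum : S = ∑ j ∈ Finset.range D.m, w j
  nonneg : ∀ j < D.m, 0 ≤ X j
  sum_avg : ∑ j ∈ Finset.range D.m, X j = i
  le_exp : ∀ t < D.M, S ≤ D.m * Real.exp (D.load (1, 1, 1) X t)
  le_prod : ∀ H, D.Hits H → 2 ^ i ≤ ∏ j ∈ H, w j

theorem Instance.Weights.zero {D : Instance} {w X : ℕ → ℝ} (hw : ∀ j < D.m, w j = 1)
    (hX : ∀ j < D.m, X j = 0) : D.Weights 0 w X D.m where
  one_le j hj := (hw j hj).ge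
  sum := by
    rw [Finset.sum_congr rfl fun j hj => hw j (Finset.mem_range.1 hj)]
    simp
  nonneg j hj := (hX j hj).ge
  sum_avg := by
    rw [Finset.sum_congr rfl fun j hj => hX j (Finset.mem_range.1 hj)]
    simp
  le_exp t _ := by
    have : D.load (1, 1, 1) X t = 0 := by
      rw [Instance.load]
      refine Finset.sum_eq_zero fun j hj => ?_
      rw [hX j (Finset.mem_range.1 hj), ite_self]
    simp [this]
  le_prod H hH := by
    rw [Finset.prod_congr rfl fun j hj => hw j (Finset.mem_range.1 (hH.1 hj))]
    simp

-- Two estimates of the same growth. Above: `S` is multiplied by `1 + load p / S`, which by the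
-- minimality of `p` and `1 + x ≤ exp x` is at most `exp (load t / S)` for every target `t`; the
-- exponents accumulate in the load of `X`. Below: a hitting set `H` contains a guard that sees `p`,
-- whose weight is doubled, so the product of the weights over `H` at least doubles.
open Classical in
theorem Instance.Weights.step {D : Instance} {i p : ℕ} {w X w' X' : ℕ → ℝ} {S : ℝ}
    (h : D.Weights i w X S) (hm : 0 < D.m) (hp : p < D.M)
    (hmin : ∀ t < D.M, D.load (1, 1, 1) w p ≤ D.load (1, 1, 1) w t)
    (hw : ∀ j < D.m, w' j = if D.Rel (1, 1, 1) j p then w j + w j else w j)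
    (hX : ∀ j < D.m, X' j = X j + w j / S) :
    D.Weights (i + 1) w' X' (S + D.load (1, 1, 1) w p) := by
  have hw0 : ∀ j < D.m, 0 ≤ w j := fun j hj => zero_le_one.trans (h.one_le j hj)
  have hS : 0 < S := by
    rw [h.sum]
    exact Finset.sum_pos (fun j hj => by linarith [h.one_le j (Finset.mem_range.1 hj)])
      ⟨0, Finset.mem_range.2 hm⟩
  have hww : ∀ j < D.m, w j ≤ w' j := fun j hj => by
    rw [hw j hj]; split_ifs <;> linarith [hw0 j hj]
  refine ⟨fun j hj => (h.one_le j hj).trans (hww j hj), ?_, fun j hj => ?_, ?_, fun t ht => ?_,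
    fun H hH => ?_⟩
  · rw [h.sum, Instance.load, ← Finset.sum_add_distrib]
    refine Finset.sum_congr rfl fun j hj => ?_
    rw [hw j (Finset.mem_range.1 hj)]
    split_ifs <;> simp
  · rw [hX j hj]
    exact add_nonneg (h.nonneg j hj) (div_nonneg (hw0 j hj) hS.le)
  · rw [Finset.sum_congr rfl fun j hj => hX j (Finset.mem_range.1 hj), Finset.sum_add_distrib,
      h.sum_avg, ← Finset.sum_div, ← h.sum, div_self hS.ne']
    simp
  · rw [Instance.load_congr hX, Instance.load_add, Instance.load_div, Real.exp_add, ← mul_assoc]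
    have h1 := h.le_exp t ht
    have h2 : D.load (1, 1, 1) w p / S ≤ D.load (1, 1, 1) w t / S :=
      div_le_div_of_nonneg_right (hmin t ht) hS.le
    have h3 := Real.add_one_le_exp (D.load (1, 1, 1) w t / S)
    calc S + D.load (1, 1, 1) w p = S * (D.load (1, 1, 1) w p / S + 1) := by field_simp; ring
      _ ≤ S * Real.exp (D.load (1, 1, 1) w t / S) := by gcongr; linarith
      _ ≤ _ := by gcongr
  · obtain ⟨q, hq, hqp⟩ := hH.2 p hp
    have hq' : q < D.m := Finset.mem_range.1 (hH.1 hq)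
    have h1 := h.le_prod H hH
    rw [← Finset.mul_prod_erase H _ hq] at h1 ⊢
    rw [hw q hq', if_pos (Instance.rel_all.2 hqp), pow_succ]
    have h2 : ∏ j ∈ H.erase q, w j ≤ ∏ j ∈ H.erase q, w' j :=
      Finset.prod_le_prod (fun j hj => hw0 j (Finset.mem_range.1 (hH.1 (Finset.mem_of_mem_erase hj))))
        fun j hj => hww j (Finset.mem_range.1 (hH.1 (Finset.mem_of_mem_erase hj)))
    have h3 := mul_le_mul_of_nonneg_left h2 (hw0 q hq')
    linarith

/-- After `6 m ^ 2` rounds the sum of the normalized weights is a good fractional solution. -/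
theorem Instance.Weights.le_load {D : Instance} {w X : ℕ → ℝ} {S : ℝ}
    (h : D.Weights (D.m * (6 * D.m)) w X S) (hm : 0 < D.m) {H : Finset ℕ} (hH : D.Hits H)
    {t : ℕ} (ht : t < D.M) :
    ((D.m * (6 * D.m) : ℕ) : ℝ) ≤ 2 * H.card * D.load (1, 1, 1) X t := by
  have hw0 : ∀ j < D.m, 0 ≤ w j := fun j hj => zero_le_one.trans (h.one_le j hj)
  have hmr : (1 : ℝ) ≤ D.m := by exact_mod_cast hm
  -- Each weight is at most `S`, so `2 ^ R ≤ S ^ |H| ≤ (m * exp (load)) ^ |H|` with `R = 6 * m ^ 2`.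
  -- Taking logarithms gives `R * log 2 ≤ |H| * log m + |H| * load`.
  have h1 : (2 : ℝ) ^ (D.m * (6 * D.m)) ≤ S ^ H.card := by
    refine (h.le_prod H hH).trans ?_
    refine (Finset.prod_le_prod (fun j hj => hw0 j (Finset.mem_range.1 (hH.1 hj)))
      fun j hj => ?_).trans (Finset.prod_const S).le
    rw [h.sum]
    exact Finset.single_le_sum (f := w) (fun i hi => hw0 i (Finset.mem_range.1 hi)) (hH.1 hj)
  have hS : 0 ≤ S := by
    rw [h.sum]; exact Finset.sum_nonneg fun i hi => hw0 i (Finset.mem_range.1 hi)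
  have h2 : (2 : ℝ) ^ (D.m * (6 * D.m)) ≤
      ((D.m : ℝ) * Real.exp (D.load (1, 1, 1) X t)) ^ H.card :=
    h1.trans (pow_le_pow_left₀ hS (h.le_exp t ht) _)
  have hmpos : (0 : ℝ) < D.m := by linarith
  have h3 := Real.log_le_log (by positivity) h2
  rw [Real.log_pow, Real.log_pow, Real.log_mul hmpos.ne' (Real.exp_pos _).ne', Real.log_exp] at h3
  have h4 := Real.log_two_gt_d9
  have h5 := Real.log_le_sub_one_of_pos hmpos
  have h6 : (H.card : ℝ) ≤ D.m := by
    have := Finset.card_le_card hH.1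
    rw [Finset.card_range] at this
    exact_mod_cast this
  have h7 : (H.card : ℝ) * Real.log D.m ≤ D.m * D.m :=
    mul_le_mul h6 (by linarith) (Real.log_nonneg hmr) hmpos.le
  push_cast at h3 ⊢
  -- The constant `6` makes the error term harmless: `|H| * log m ≤ m ^ 2`, and `6 * log 2 - 1 ≥ 3`
  -- leaves at least `R / 2`.
  nlinarith [mul_pos hmpos hmpos]

/-- One round of the multiplicative-weights algorithm. -/
def stepP : Prog :=
  .seq (argminP (.seq (loadP 7) (.op (.natConst 34 1))) 11 4) (.seq (.op (.natAdd 11 30 3))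
  -- For each guard the normalized weight is added to array `8` before the weight in array `7` is
  -- doubled, and the sum in real variable `21` is updated only after the loop. All quotients
  -- therefore use the old weights and the old sum.
  (.seq (forP 10 1 (.seq (ops [.realLoad 10 7 10, .realDiv 11 10 21, .realLoad 12 8 10,
      .realAdd 12 12 11, .realStore 8 10 12])
    (.seq seesP (.branch (.natLt 3 13)
      (ops [.realLoad 10 7 10, .realAdd 10 10 10, .realStore 7 10 10]) .skip))))
  (.op (.realAdd 21 21 22))))

/-- The running time of `stepP`. -/
def stepT {R : Type*} [CommSemiring R] (B : R) : R :=
  argminT B (loadT B + 1) + (1 + (forT B (5 + (seesT B + 4)) + 1))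

theorem runs_step {D : Instance} {N i : ℕ} (h : Env D s) (hN : D.n ≤ N) (hm : D.m ≤ N)
    (hM : D.M ≤ N) (hM0 : 0 < D.M) (hm0 : 0 < D.m) (hc : s.cls = (1, 1, 1))
    (hW : D.Weights i (s.realArr 7) (s.realArr 8) (s.realVar 21)) :
    Runs stepP s (stepT N)
      (fun s' => D.Weights (i + 1) (s'.realArr 7) (s'.realArr 8) (s'.realVar 21)) := by
  classical
  refine (runs_argmin (τ := loadT N + 1) (N := N) (fun _ => True)
    (D.load (1, 1, 1) (s.realArr 7)) h.M hM h.one h.zero h.rzero rfl ?_).seq ?_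
  · intro k hk s₁ hF₁ hi
    have hE₁ := h.of_frame hF₁ rfl
    have hc₁ : s₁.cls = (1, 1, 1) := by
      rw [← hc]
      simp only [State.cls, hF₁.nat 20 rfl, hF₁.nat 21 rfl, hF₁.nat 22 rfl]
    refine (runs_load (a := 7) hE₁ hN hm).seq ?_
    intro s₂ hF₂ hs
    refine runs_op _ ?_
    simp [hs, hc₁, hF₁.realArr 7 rfl, hi]
  intro s₁ hF₁ hs₁
  have hE₁ := h.of_frame hF₁ rfl
  obtain ⟨-, hno⟩ | ⟨-, hp, -, hb, hmin⟩ := hs₁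
  · exact (hno 0 hM0 trivial).elim
  refine (runs_op (A := fun s' => s'.natVar 11 = s₁.natVar 30) _ (by simp [hE₁.zero])).seq ?_
  intro s₂ hF₂ h11
  have hE₂ := hE₁.of_frame hF₂ rfl
  have hc₂ : s₂.cls = (1, 1, 1) := by
    rw [← hc]
    simp only [State.cls, hF₁.nat 20 rfl, hF₁.nat 21 rfl, hF₁.nat 22 rfl, hF₂.nat 20 rfl,
      hF₂.nat 21 rfl, hF₂.nat 22 rfl]
  have h7 : s₂.realArr 7 = s.realArr 7 := (hF₂.realArr 7 rfl).trans (hF₁.realArr 7 rfl)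
  have h8 : s₂.realArr 8 = s.realArr 8 := (hF₂.realArr 8 rfl).trans (hF₁.realArr 8 rfl)
  have h21 : s₂.realVar 21 = s.realVar 21 := (hF₂.real 21 rfl).trans (hF₁.real 21 rfl)
  have h22 : s₂.realVar 22 = s₁.realVar 22 := hF₂.real 22 rfl
  generalize s₁.natVar 30 = p at *
  generalize hw : s.realArr 7 = w at *
  generalize hX : s.realArr 8 = X at *
  generalize hS : s.realVar 21 = S at *
  refine (runs_for (L := D.m) (N := N) (τ := 5 + (seesT N + 4)) (fun k s' =>
    (∀ j, s'.realArr 7 j = if j < k ∧ D.Rel (1, 1, 1) j p then w j + w j else w j) ∧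
    (∀ j, s'.realArr 8 j = if j < k then X j + w j / S else X j))
    hE₂.m hm hE₂.one rfl (by simp [h7, h8]) ?_).seq ?_
  · intro k hk s₃ hF₃ hi ⟨hI7, hI8⟩
    have hE₃ := hE₂.of_frame hF₃ rfl
    have hc₃ : s₃.cls = (1, 1, 1) := by
      rw [← hc₂]
      simp only [State.cls, hF₃.nat 20 rfl, hF₃.nat 21 rfl, hF₃.nat 22 rfl]
    have h11₃ := (hF₃.nat 11 rfl).trans h11
    have h21₃ := (hF₃.real 21 rfl).trans h21
    refine (runs_ops (A := fun s' => (∀ j, s'.realArr 8 j =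
      if j < k + 1 then X j + w j / S else X j)) _ ?_).seq ?_
    · intro j
      simp only [runOps, Instr.run, State.setReal, State.setRealArr, hi, Function.update_apply,
        h21₃, hI7, hI8, if_true]
      by_cases hjk : j = k
      · subst hjk; simp
      · have : j < k + 1 ↔ j < k := by omega
        simp [hjk, this]
    intro s₄ hF₄ h8₄
    have hE₄ := hE₃.of_frame hF₄ rfl
    have hc₄ : s₄.cls = (1, 1, 1) := by
      rw [← hc₃]
      simp only [State.cls, hF₄.nat 20 rfl, hF₄.nat 21 rfl, hF₄.nat 22 rfl]
    refine (runs_sees hE₄ hN).seq ?_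
    intro s₅ hF₅ hs
    have hE₅ := hE₄.of_frame hF₅ rfl
    have h10 : s₅.natVar 10 = k := (hF₅.nat 10 rfl).trans ((hF₄.nat 10 rfl).trans hi)
    rw [hc₄, hF₄.nat 10 rfl, hi, hF₄.nat 11 rfl, h11₃] at hs
    have h7₅ : s₅.realArr 7 = s₃.realArr 7 := (hF₅.realArr 7 rfl).trans (hF₄.realArr 7 rfl)
    have h8₅ := hF₅.realArr 8 rfl
    refine runs_branch (τ := 3) (fun hc => ?_) (fun hc => ?_) <;>
      simp only [Cond.Holds, hE₅.zero, hs] at hc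
    · refine runs_ops _ ⟨fun j => ?_, fun j => ?_⟩
      · by_cases hjk : j = k
        · subst hjk; simp [h7₅, hI7, h10, hc]
        · have : j < k + 1 ↔ j < k := by omega
          simp [h7₅, hI7, h10, hjk, this]
      · simp [h8₅, h8₄]
    · refine (runs_skip ⟨fun j => ?_, fun j => ?_⟩).mono (by omega) (fun _ _ h => h)
      · by_cases hjk : j = k
        · subst hjk; simp [h7₅, hI7, hc]
        · have : j < k + 1 ↔ j < k := by omega
          simp [h7₅, hI7, this]
      · simp [h8₅, h8₄]
  intro s₃ hF₃ ⟨h7₃, h8₃⟩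
  refine runs_op _ ?_
  have : D.Weights (i + 1) (s₃.realArr 7) (s₃.realArr 8) (S + D.load (1, 1, 1) w p) :=
    hW.step hm0 hp (fun t ht => hmin t ht trivial) (fun j hj => by simp [h7₃, hj])
      (fun j hj => by simp [h8₃, hj])
  simpa [hF₃.real 21 rfl, h21, hF₃.real 22 rfl, h22, hb] using this

/-- The multiplicative-weights algorithm. -/
def weightsP : Prog :=
  .seq (ops [.realConst 25 1, .realConst 21 0]) (.seq
  (forP 10 1 (ops [.realStore 7 10 25, .realAdd 21 21 25])) (.seq
  -- There is no multiplication of natural numbers: `6 * m` comes from additions, and the next loop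
  -- adds it `m` times to obtain the number of rounds.
  (ops [.natAdd 23 1 1, .natAdd 23 23 1, .natAdd 24 23 23, .natConst 25 0]) (.seq
  (forP 26 1 (.op (.natAdd 25 25 24))) (.seq
  (ops [.natConst 20 1, .natConst 21 1, .natConst 22 1])
  (forP 26 25 stepP)))))

/-- The running time of `weightsP`. -/
def weightsT {R : Type*} [CommSemiring R] (B : R) : R :=
  2 + (forT B 2 + (4 + (forT B 1 + (3 + forT B (stepT B)))))

theorem runs_weights {D : Instance} {N : ℕ} (h : Env D s) (hN : D.n ≤ N) (hm : D.m ≤ N)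
    (hM : D.M ≤ N) (hM0 : 0 < D.M) (hm0 : 0 < D.m) (hN' : D.m * (6 * D.m) ≤ N)
    (h8 : ∀ j < D.m, s.realArr 8 j = 0) :
    Runs weightsP s (weightsT N)
      (fun s' => ∃ w S, D.Weights (D.m * (6 * D.m)) w (s'.realArr 8) S) := by
  refine (runs_ops (A := fun s' => s'.realVar 25 = 1 ∧ s'.realVar 21 = 0) _ (by simp)).seq ?_
  intro s₁ hF₁ ⟨h25, h21⟩
  have hE₁ := h.of_frame hF₁ rfl
  refine (runs_for (L := D.m) (N := N) (τ := 2) (fun k s' =>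
    (∀ j < k, s'.realArr 7 j = 1) ∧ s'.realVar 21 = k)
    hE₁.m hm hE₁.one rfl (by simp [h21]) ?_).seq ?_
  · intro k hk s₂ hF₂ hi ⟨hI7, hI21⟩
    refine runs_ops _ ⟨fun j hj => ?_, ?_⟩
    · have h25' := (hF₂.real 25 rfl).trans h25
      by_cases hjk : j = k
      · subst hjk; simp [hi, h25']
      · simp [hi, hjk, hI7 j (by omega)]
    · simp [hI21, (hF₂.real 25 rfl).trans h25]
  intro s₂ hF₂ ⟨h7₂, h21₂⟩
  have hE₂ := hE₁.of_frame hF₂ rfl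
  refine (runs_ops (A := fun s' => s'.natVar 24 = 6 * D.m ∧ s'.natVar 25 = 0) _
    (by simp [hE₂.m]; ring)).seq ?_
  intro s₃ hF₃ ⟨h24, h25'⟩
  have hE₃ := hE₂.of_frame hF₃ rfl
  refine (runs_for (L := D.m) (N := N) (τ := 1) (fun k s' => s'.natVar 25 = k * (6 * D.m))
    hE₃.m hm hE₃.one rfl (by simp [h25']) ?_).seq ?_
  · intro k hk s₄ hF₄ hi hI
    refine runs_op _ ?_
    simp [hI, (hF₄.nat 24 rfl).trans h24]; ring
  intro s₄ hF₄ h25₄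
  have hE₄ := hE₃.of_frame hF₄ rfl
  refine (runs_ops (A := fun s' => s'.cls = (1, 1, 1)) _ (by simp [State.cls])).seq ?_
  intro s₅ hF₅ hc
  have hE₅ := hE₄.of_frame hF₅ rfl
  have e7 : s₅.realArr 7 = s₂.realArr 7 :=
    (hF₅.realArr 7 rfl).trans ((hF₄.realArr 7 rfl).trans (hF₃.realArr 7 rfl))
  have e8 : s₅.realArr 8 = s.realArr 8 :=
    (hF₅.realArr 8 rfl).trans ((hF₄.realArr 8 rfl).trans ((hF₃.realArr 8 rfl).trans
      ((hF₂.realArr 8 rfl).trans (hF₁.realArr 8 rfl))))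
  have e21 : s₅.realVar 21 = D.m :=
    (hF₅.real 21 rfl).trans ((hF₄.real 21 rfl).trans ((hF₃.real 21 rfl).trans h21₂))
  refine (runs_for (N := N) (fun k s' =>
    D.Weights k (s'.realArr 7) (s'.realArr 8) (s'.realVar 21))
    ((hF₅.nat 25 rfl).trans h25₄) hN' hE₅.one rfl ?_ ?_).conseq (fun _ _ h => ⟨_, _, h⟩)
  · have := Instance.Weights.zero (D := D) (w := s₂.realArr 7) (X := s.realArr 8) h7₂ h8
    simpa [e7, e8, e21] using this
  · intro k hk s₆ hF₆ hi hI
    have hc₆ : s₆.cls = (1, 1, 1) := by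
      rw [← hc]
      simp only [State.cls, hF₆.nat 20 rfl, hF₆.nat 21 rfl, hF₆.nat 22 rfl]
    exact runs_step (hE₅.of_frame hF₆ rfl) hN hm hM hM0 hm0 hc₆ hI

/-! ### Greedy rounding within one class of relative positions -/

/-- If guard `j` sees targets `t` and `t'`, where `t` does not come after `t'` in the order given by
the sign `σ`, then so does every guard that sees `t` and does not come after `j`. -/
def Instance.Crossing (D : Instance) (c : ℕ × ℕ × ℕ) (σ : ℝ) : Prop :=
  ∀ j q t t', q < D.m → j < D.m → t < D.M → t' < D.M → D.Rel c j t → D.Rel c j t' →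
    D.tx t * σ ≤ D.tx t' * σ → D.Rel c q t → D.gx q * σ ≤ D.gx j * σ → D.Rel c q t'

/-- The state of the greedy algorithm: it has chosen the guards in `C` because of the targets in
`W`; the targets in `A` have to be seen, and those with positive `a t` are still to be treated. -/
structure Instance.Greedy (D : Instance) (c : ℕ × ℕ × ℕ) (A : ℕ → Prop) (C W : Finset ℕ)
    (a : ℕ → ℕ) : Prop where
  subset : C ⊆ Finset.range D.m
  card_le : C.card ≤ W.card
  witness : ∀ t ∈ W, t < D.M ∧ A t
  active : ∀ t < D.M, 0 < a t → A t
  covered : ∀ t < D.M, A t → a t = 0 → ∃ j ∈ C, D.Rel c j t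
  disjoint : ∀ t ∈ W, ∀ t' ∈ W, t ≠ t' → ∀ j < D.m, D.Rel c j t → ¬ D.Rel c j t'
  later : ∀ t ∈ W, ∀ t' < D.M, 0 < a t' → ∀ j < D.m, D.Rel c j t → ¬ D.Rel c j t'

-- The point is that a guard `j` that sees `p` sees no target that remains after the round. Such a
-- target `t'` does not come before `p`, and `q` does not come after `j`, so `Instance.Crossing`
-- makes `q` see `t'` as well; but then `t'` was removed. Hence `p` is a new witness, independent of
-- all earlier and later ones.
open Classical in
theorem Instance.Greedy.step {D : Instance} {c : ℕ × ℕ × ℕ} {A : ℕ → Prop} {C W : Finset ℕ}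
    {a a' : ℕ → ℕ} {σ : ℝ} {p q : ℕ} (h : D.Greedy c A C W a) (hD : D.Crossing c σ)
    (hp : p < D.M) (hap : 0 < a p) (hmin : ∀ t < D.M, 0 < a t → D.tx p * σ ≤ D.tx t * σ)
    (hq : q < D.m) (hqp : D.Rel c q p)
    (hmin' : ∀ j < D.m, D.Rel c j p → D.gx q * σ ≤ D.gx j * σ)
    (ha : ∀ t < D.M, a' t = if D.Rel c q t then 0 else a t) :
    D.Greedy c A (insert q C) (insert p W) a' := by
  have hpos : ∀ t < D.M, 0 < a' t → 0 < a t ∧ ¬ D.Rel c q t := fun t ht h => by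
    rw [ha t ht] at h
    split_ifs at h with h'
    exacts [(lt_irrefl _ h).elim, ⟨h, h'⟩]
  have hnew : ∀ t' < D.M, 0 < a' t' → ∀ j < D.m, D.Rel c j p → ¬ D.Rel c j t' := by
    intro t' ht' hat j hj hjp hjt
    obtain ⟨hat, hqt⟩ := hpos t' ht' hat
    exact hqt (hD j q p t' hq hj hp ht' hjp hjt (hmin t' ht' hat) hqp (hmin' j hj hjp))
  have hpW : p ∉ W := fun hpW => h.later p hpW p hp hap q hq hqp hqp
  refine ⟨?_, ?_, ?_, ?_, ?_, ?_, ?_⟩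
  · exact Finset.insert_subset (Finset.mem_range.2 hq) h.subset
  · rw [Finset.card_insert_of_notMem hpW]
    exact (Finset.card_insert_le _ _).trans (by have := h.card_le; omega)
  · intro t ht
    rcases Finset.mem_insert.1 ht with rfl | ht
    exacts [⟨hp, h.active _ hp hap⟩, h.witness t ht]
  · exact fun t ht hat => h.active t ht (hpos t ht hat).1
  · intro t ht hA hat
    rw [ha t ht] at hat
    split_ifs at hat with h'
    · exact ⟨q, Finset.mem_insert_self _ _, h'⟩
    · obtain ⟨j, hj, hjt⟩ := h.covered t ht hA hat
      exact ⟨j, Finset.mem_insert_of_mem hj, hjt⟩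
  · intro t ht t' ht' hne j hj hjt hjt'
    rcases Finset.mem_insert.1 ht with h₁ | h₁ <;> rcases Finset.mem_insert.1 ht' with h₂ | h₂
    · exact hne (h₁.trans h₂.symm)
    · exact h.later t' h₂ t (h₁ ▸ hp) (h₁ ▸ hap) j hj hjt' hjt
    · exact h.later t h₁ t' (h₂ ▸ hp) (h₂ ▸ hap) j hj hjt hjt'
    · exact h.disjoint t h₁ t' h₂ hne j hj hjt hjt'
  · intro t ht t' ht' hat
    rcases Finset.mem_insert.1 ht with rfl | ht
    · exact hnew t' ht' hat
    · exact h.later t ht t' ht' (hpos t' ht' hat).1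

/-- Weak duality: every witness has load at least `θ`, and each guard contributes to the load of at
most one witness, so exchanging the sums bounds the loads of all witnesses by the total of `X`. -/
theorem Instance.Greedy.card_mul_le {D : Instance} {c : ℕ × ℕ × ℕ} {A : ℕ → Prop}
    {C W : Finset ℕ} {a : ℕ → ℕ} {X : ℕ → ℝ} {θ : ℝ} (h : D.Greedy c A C W a)
    (hX : ∀ j < D.m, 0 ≤ X j) (hθ : 0 ≤ θ) (hA : ∀ t < D.M, A t → θ ≤ D.load c X t) :
    C.card * θ ≤ ∑ j ∈ Finset.range D.m, X j := by
  classical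
  calc (C.card : ℝ) * θ ≤ W.card * θ := by
        have : (C.card : ℝ) ≤ W.card := by exact_mod_cast h.card_le
        gcongr
    _ = ∑ t ∈ W, θ := by simp
    _ ≤ ∑ t ∈ W, D.load c X t :=
        Finset.sum_le_sum fun t ht => hA t (h.witness t ht).1 (h.witness t ht).2
    _ = ∑ j ∈ Finset.range D.m, ∑ t ∈ W, if D.Rel c j t then X j else 0 := by
        simp only [Instance.load]; rw [Finset.sum_comm]
    _ ≤ _ := Finset.sum_le_sum fun j hj => ?_
  have hj' := Finset.mem_range.1 hj
  by_cases hex : ∃ t ∈ W, D.Rel c j t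
  · obtain ⟨t, ht, hjt⟩ := hex
    rw [Finset.sum_eq_single_of_mem t ht, if_pos hjt]
    intro t' ht' hne
    exact if_neg (h.disjoint t ht t' ht' hne.symm j hj' hjt)
  · push Not at hex
    rw [Finset.sum_eq_zero fun t ht => if_neg (hex t ht)]
    exact hX j hj'

/-- Mark in array `1` the targets for which the allowed relative positions `a b c` account for at
least a third of the load. -/
def activateP (a b c : ℕ) : Prog :=
  forP 11 4 (.seq (ops [.natConst 20 1, .natConst 21 1, .natConst 22 1]) (.seq (loadP 8)
  (.seq (ops [.realAdd 25 24 20, .natConst 20 a, .natConst 21 b, .natConst 22 c])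
  (.seq (loadP 8) (.seq (ops [.realAdd 26 24 24, .realAdd 24 26 24, .natConst 13 0])
  (.seq (.branch (.realLe 25 24) (.op (.natConst 13 1)) .skip) (.op (.natStore 1 11 13))))))))

/-- The running time of `activateP`. -/
def activateT {R : Type*} [CommSemiring R] (B : R) : R :=
  forT B (3 + (loadT B + (4 + (loadT B + (3 + (2 + 1))))))

theorem runs_activate {D : Instance} {N a b c : ℕ} (h : Env D s) (hN : D.n ≤ N) (hm : D.m ≤ N)
    (hM : D.M ≤ N) :
    Runs (activateP a b c) s (activateT N) (fun s' => ∀ t < D.M, 0 < s'.natArr 1 t ↔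
      D.load (1, 1, 1) (s.realArr 8) t ≤ 3 * D.load (a, b, c) (s.realArr 8) t) := by
  refine runs_for (L := D.M) (N := N) (fun k s' => ∀ t < k, 0 < s'.natArr 1 t ↔
    D.load (1, 1, 1) (s.realArr 8) t ≤ 3 * D.load (a, b, c) (s.realArr 8) t) h.M hM h.one rfl
    (fun t ht => by omega) ?_
  intro k hk s₁ hF₁ hi hI
  have hE₁ := h.of_frame hF₁ rfl
  have e8 := hF₁.realArr 8 rfl
  refine (runs_ops (A := fun s' => s'.cls = (1, 1, 1)) _ (by simp [State.cls])).seq ?_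
  intro s₂ hF₂ hc₂
  have hE₂ := hE₁.of_frame hF₂ rfl
  have hi₂ := (hF₂.nat 11 rfl).trans hi
  have e8₂ := (hF₂.realArr 8 rfl).trans e8
  refine (runs_load (a := 8) hE₂ hN hm).seq ?_
  intro s₃ hF₃ hs₃
  rw [hc₂, hi₂, e8₂] at hs₃
  have hE₃ := hE₂.of_frame hF₃ rfl
  have hi₃ := (hF₃.nat 11 rfl).trans hi₂
  have e8₃ := (hF₃.realArr 8 rfl).trans e8₂
  refine (runs_ops (A := fun s' => s'.cls = (a, b, c) ∧
    s'.realVar 25 = D.load (1, 1, 1) (s.realArr 8) k) _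
    (by simp [State.cls, hs₃, hE₃.rzero])).seq ?_
  intro s₄ hF₄ ⟨hc₄, h25⟩
  have hE₄ := hE₃.of_frame hF₄ rfl
  have hi₄ := (hF₄.nat 11 rfl).trans hi₃
  have e8₄ := (hF₄.realArr 8 rfl).trans e8₃
  refine (runs_load (a := 8) hE₄ hN hm).seq ?_
  intro s₅ hF₅ hs₅
  rw [hc₄, hi₄, e8₄] at hs₅
  have hE₅ := hE₄.of_frame hF₅ rfl
  have hi₅ := (hF₅.nat 11 rfl).trans hi₄
  have h25₅ := (hF₅.real 25 rfl).trans h25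
  refine (runs_ops (A := fun s' => s'.natVar 13 = 0 ∧
    s'.realVar 24 = 3 * D.load (a, b, c) (s.realArr 8) k) _ (by simp [hs₅]; ring)).seq ?_
  intro s₆ hF₆ ⟨h13, h24⟩
  have hi₆ := (hF₆.nat 11 rfl).trans hi₅
  have h25₆ := (hF₆.real 25 rfl).trans h25₅
  refine Runs.seq (τ := 2) (A := fun s' => 0 < s'.natVar 13 ↔
      D.load (1, 1, 1) (s.realArr 8) k ≤ 3 * D.load (a, b, c) (s.realArr 8) k) ?_ ?_
  · refine runs_branch (τ := 1) (fun hd => ?_) (fun hd => ?_) <;>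
      simp only [Cond.Holds, h25₆, h24] at hd
    · exact runs_op _ (by simp [hd])
    · exact (runs_skip (by simp [hd, h13])).mono (by omega) (fun _ _ h => h)
  intro s₇ hF₇ hs₇
  have hi₇ := (hF₇.nat 11 rfl).trans hi₆
  have ea : s₇.natArr 1 = s₁.natArr 1 :=
    (hF₇.natArr 1 rfl).trans ((hF₆.natArr 1 rfl).trans ((hF₅.natArr 1 rfl).trans
      ((hF₄.natArr 1 rfl).trans ((hF₃.natArr 1 rfl).trans (hF₂.natArr 1 rfl)))))
  refine runs_op _ ?_
  intro t ht
  by_cases htk : t = k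
  · subst htk; simpa [hi₇] using hs₇
  · simpa [hi₇, htk, ea] using hI t (by omega)

/-- One round of the greedy algorithm. -/
def roundP : Prog :=
  .seq (argminP (ops [.natLoad 34 1 11, .realLoad 24 4 11, .realMul 24 24 27]) 11 4)
  (.branch (.natLt 3 31)
    (.seq (.op (.natAdd 11 30 3))
    (.seq (argminP (.seq seesP (ops [.natAdd 34 13 3, .realLoad 24 2 10, .realMul 24 24 27])) 10 1)
    (.seq (ops [.natStore 0 30 2, .natAdd 10 30 3])
    (forP 11 4 (.seq seesP (.branch (.natLt 3 13) (.op (.natStore 1 11 3)) .skip))))))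
    .skip)

/-- The running time of `roundP`. -/
def roundT {R : Type*} [CommSemiring R] (B : R) : R :=
  argminT B 3 + ((1 + (argminT B (seesT B + 3) + (2 + forT B (seesT B + 2)))) + 1)

/-- `C` has been added to the set of chosen guards. -/
def Added (C : Finset ℕ) (o o' : ℕ → ℕ) : Prop := ∀ j, o' j = 1 ↔ o j = 1 ∨ j ∈ C

-- The number of untreated targets drops in each round, because `q` sees `p`. After `D.M` rounds
-- none is left, so a fixed number of rounds suffices. `hA` guarantees that the search for a guard
-- succeeds.
open Classical in
theorem runs_round {D : Instance} {N r : ℕ} {c : ℕ × ℕ × ℕ} {A : ℕ → Prop} {o : ℕ → ℕ} {σ : ℝ}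
    (h : Env D s) (hN : D.n ≤ N) (hm : D.m ≤ N) (hM : D.M ≤ N) (hc : s.cls = c)
    (hσ : s.realVar 27 = σ) (hD : D.Crossing c σ) (hA : ∀ t < D.M, A t → ∃ j < D.m, D.Rel c j t)
    (hG : ∃ C W, Added C o (s.natArr 0) ∧ D.Greedy c A C W (s.natArr 1))
    (hr : ((Finset.range D.M).filter (0 < s.natArr 1 ·)).card ≤ D.M - r) :
    Runs roundP s (roundT N) (fun s' =>
      (∃ C W, Added C o (s'.natArr 0) ∧ D.Greedy c A C W (s'.natArr 1)) ∧
      ((Finset.range D.M).filter (0 < s'.natArr 1 ·)).card ≤ D.M - (r + 1)) := by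
  refine (runs_argmin (τ := 3) (N := N) (fun t => 0 < s.natArr 1 t)
    (fun t => D.tx t * σ) h.M hM h.one h.zero h.rzero rfl ?_).seq ?_
  · intro k hk s₁ hF₁ hi
    have hE₁ := h.of_frame hF₁ rfl
    exact runs_ops _ (by simp [hi, hF₁.natArr 1 rfl, hE₁.tx, hF₁.real 27 rfl, hσ])
  intro s₁ hF₁ hs₁
  have hE₁ := h.of_frame hF₁ rfl
  have ea₁ := hF₁.natArr 1 rfl
  have eo₁ := hF₁.natArr 0 rfl
  obtain ⟨h31, hno⟩ | ⟨h31, hp, hap, -, hmin⟩ := hs₁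
  · refine runs_branch (fun hd => ?_) (fun hd => ?_)
    · simp [h31] at hd
    · refine (runs_skip ?_).mono (by omega) (fun _ _ h => h)
      rw [ea₁, eo₁]
      refine ⟨hG, ?_⟩
      -- An idle round: nothing is left to treat, so the count is `0` and any bound holds.
      rw [Finset.filter_eq_empty_iff.2 fun t ht => hno t (Finset.mem_range.1 ht)]
      simp
  refine runs_branch (fun _ => ?_) (fun hd => by simp [h31, hE₁.zero] at hd)
  refine (runs_op (A := fun s' => s'.natVar 11 = s₁.natVar 30) _ (by simp [hE₁.zero])).seq ?_
  intro s₂ hF₂ h11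
  have hE₂ := hE₁.of_frame hF₂ rfl
  have ea₂ := (hF₂.natArr 1 rfl).trans ea₁
  have eo₂ := (hF₂.natArr 0 rfl).trans eo₁
  have hσ₂ := (hF₂.real 27 rfl).trans ((hF₁.real 27 rfl).trans hσ)
  have hc₂ : s₂.cls = c := by
    rw [← hc]
    simp only [State.cls, hF₁.nat 20 rfl, hF₁.nat 21 rfl, hF₁.nat 22 rfl, hF₂.nat 20 rfl,
      hF₂.nat 21 rfl, hF₂.nat 22 rfl]
  generalize s₁.natVar 30 = p at *
  refine (runs_argmin (τ := seesT N + 3) (N := N) (fun j => D.Rel c j p)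
    (fun j => D.gx j * σ) hE₂.m hm hE₂.one hE₂.zero hE₂.rzero rfl ?_).seq ?_
  · intro k hk s₃ hF₃ hi
    have hE₃ := hE₂.of_frame hF₃ rfl
    have hc₃ : s₃.cls = c := by
      rw [← hc₂]
      simp only [State.cls, hF₃.nat 20 rfl, hF₃.nat 21 rfl, hF₃.nat 22 rfl]
    have h11₃ := (hF₃.nat 11 rfl).trans h11
    refine (runs_sees hE₃ hN).seq ?_
    intro s₄ hF₄ hs₄
    rw [hc₃, hi, h11₃] at hs₄
    have hE₄ := hE₃.of_frame hF₄ rfl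
    have hσ₄ := (hF₄.real 27 rfl).trans ((hF₃.real 27 rfl).trans hσ₂)
    exact runs_ops _ (by simp [hs₄, hE₄.zero, hE₄.gx, hσ₄, (hF₄.nat 10 rfl).trans hi])
  intro s₃ hF₃ hs₃
  have hE₃ := hE₂.of_frame hF₃ rfl
  have ea₃ := (hF₃.natArr 1 rfl).trans ea₂
  have eo₃ := (hF₃.natArr 0 rfl).trans eo₂
  have hc₃ : s₃.cls = c := by
    rw [← hc₂]
    simp only [State.cls, hF₃.nat 20 rfl, hF₃.nat 21 rfl, hF₃.nat 22 rfl]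
  obtain ⟨C, W, hC, hG⟩ := hG
  obtain ⟨h31', hno⟩ | ⟨-, hq, hqp, -, hmin'⟩ := hs₃
  · obtain ⟨j, hj, hjp⟩ := hA p hp (hG.active p hp hap)
    exact (hno j hj hjp).elim
  generalize hqs : s₃.natVar 30 = q at *
  refine (runs_ops (A := fun s' => (∀ j, s'.natArr 0 j = if j = q then 1 else s.natArr 0 j) ∧
    s'.natVar 10 = q) _ ?_).seq ?_
  · refine ⟨fun j => ?_, by simp [hqs, hE₃.zero]⟩
    by_cases hjq : j = q <;> simp [hqs, hE₃.one, eo₃, hjq]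
  intro s₄ hF₄ ⟨ho₄, h10⟩
  have hE₄ := hE₃.of_frame hF₄ rfl
  have ea₄ := (hF₄.natArr 1 rfl).trans ea₃
  have hc₄ : s₄.cls = c := by
    rw [← hc₃]
    simp only [State.cls, hF₄.nat 20 rfl, hF₄.nat 21 rfl, hF₄.nat 22 rfl]
  refine (runs_for (L := D.M) (N := N) (τ := seesT N + 2) (fun k s' =>
    ∀ t, s'.natArr 1 t = if t < k ∧ D.Rel c q t then 0 else s.natArr 1 t)
    hE₄.M hM hE₄.one rfl (by simp [ea₄]) ?_).conseq ?_
  · intro k hk s₅ hF₅ hi hI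
    have hE₅ := hE₄.of_frame hF₅ rfl
    have hc₅ : s₅.cls = c := by
      rw [← hc₄]
      simp only [State.cls, hF₅.nat 20 rfl, hF₅.nat 21 rfl, hF₅.nat 22 rfl]
    refine (runs_sees hE₅ hN).seq ?_
    intro s₆ hF₆ hs₆
    rw [hc₅, hi, (hF₅.nat 10 rfl).trans h10] at hs₆
    have hE₆ := hE₅.of_frame hF₆ rfl
    have hi₆ := (hF₆.nat 11 rfl).trans hi
    have ea₆ := hF₆.natArr 1 rfl
    refine runs_branch (τ := 1) (fun hd => ?_) (fun hd => ?_) <;>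
      simp only [Cond.Holds, hE₆.zero, hs₆] at hd
    · refine runs_op _ (fun t => ?_)
      by_cases htk : t = k
      · subst htk; simp [hi₆, hE₆.zero, hd]
      · have : t < k + 1 ↔ t < k := by omega
        simp [hi₆, ea₆, htk, hI, this]
    · refine (runs_skip (fun t => ?_)).mono (by omega) (fun _ _ h => h)
      by_cases htk : t = k
      · subst htk; simp [ea₆, hI, hd]
      · have : t < k + 1 ↔ t < k := by omega
        simp [ea₆, hI, this]
  intro s₅ hF₅ ha₅
  have eo₅ := hF₅.natArr 0 rfl
  refine ⟨⟨insert q C, insert p W, fun j => ?_, hG.step hD hp hap hmin hq hqp hmin' fun t ht => ?_⟩,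
    ?_⟩
  · rw [eo₅, ho₄, Finset.mem_insert]
    have := hC j
    split_ifs with hjq <;> simp [hjq, this]
  · simp [ha₅, ht]
  · have hlt : ((Finset.range D.M).filter (0 < s₅.natArr 1 ·)).card <
        ((Finset.range D.M).filter (0 < s.natArr 1 ·)).card := by
      refine Finset.card_lt_card ⟨fun t ht => ?_, fun hsub => ?_⟩
      · simp only [Finset.mem_filter, ha₅] at ht ⊢
        refine ⟨ht.1, ?_⟩
        have := ht.2
        split_ifs at this
        · omega
        · exact this
      · have := hsub (Finset.mem_filter.2 ⟨Finset.mem_range.2 hp, hap⟩)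
        simp [ha₅, hp, hqp] at this
    omega

/-- Choose guards in the relative positions `a b c`; targets are treated in the order given by the
sign `σ`. -/
def chooseP (a b c : ℕ) (σ : ℚ) : Prog :=
  .seq (activateP a b c)
  (.seq (ops [.natConst 20 a, .natConst 21 b, .natConst 22 c, .realConst 27 σ])
  (forP 14 4 roundP))

/-- The running time of `chooseP`. -/
def chooseT {R : Type*} [CommSemiring R] (B : R) : R := activateT B + (4 + forT B (roundT B))

/-- A target is activated if the class carries a third of its load, which is then at least `θ > 0`.
Positivity provides a guard of the class that sees it, and the bound `θ` feeds
`Instance.Greedy.card_mul_le`. -/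
theorem runs_choose {D : Instance} {N a b c : ℕ} {σ : ℚ} {θ : ℝ}
    (h : Env D s) (hN : D.n ≤ N) (hm : D.m ≤ N) (hM : D.M ≤ N) (hD : D.Crossing (a, b, c) σ)
    (hX : ∀ j < D.m, 0 ≤ s.realArr 8 j) (hθ : 0 < θ)
    (hl : ∀ t < D.M, 3 * θ ≤ D.load (1, 1, 1) (s.realArr 8) t) :
    Runs (chooseP a b c σ) s (chooseT N) (fun s' =>
      ∃ C ⊆ Finset.range D.m, Added C (s.natArr 0) (s'.natArr 0) ∧
        C.card * θ ≤ ∑ j ∈ Finset.range D.m, s.realArr 8 j ∧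
        ∀ t < D.M, D.load (1, 1, 1) (s.realArr 8) t ≤ 3 * D.load (a, b, c) (s.realArr 8) t →
          ∃ j ∈ C, D.Unobstructed j t) := by
  classical
  refine (runs_activate h hN hm hM).seq ?_
  intro s₁ hF₁ hs₁
  have hE₁ := h.of_frame hF₁ rfl
  refine (runs_ops (A := fun s' => s'.cls = (a, b, c) ∧ s'.realVar 27 = σ) _
    (by simp [State.cls])).seq ?_
  intro s₂ hF₂ ⟨hc, hσ⟩
  have hE₂ := hE₁.of_frame hF₂ rfl
  have ea := hF₂.natArr 1 rfl
  have eo := (hF₂.natArr 0 rfl).trans (hF₁.natArr 0 rfl)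
  generalize hXX : s.realArr 8 = X at *
  have hθA : ∀ t < D.M, D.load (1, 1, 1) X t ≤ 3 * D.load (a, b, c) X t →
      θ ≤ D.load (a, b, c) X t := fun t ht hA => by linarith [hl t ht]
  refine (runs_for (L := D.M) (N := N) (τ := roundT N) (fun k s' =>
    (∃ C W, Added C (s.natArr 0) (s'.natArr 0) ∧
      D.Greedy (a, b, c) (fun t => D.load (1, 1, 1) X t ≤ 3 * D.load (a, b, c) X t) C W
        (s'.natArr 1)) ∧ ((Finset.range D.M).filter (0 < s'.natArr 1 ·)).card ≤ D.M - k)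
    hE₂.M hM hE₂.one rfl ⟨⟨∅, ∅, fun j => by simp [eo], ?_⟩, ?_⟩ ?_).conseq ?_
  · refine ⟨by simp, by simp, by simp, fun t ht hat => ?_, fun t ht hA hat => ?_, by simp, by simp⟩
    · exact (hs₁ t ht).1 (by simpa [ea] using hat)
    · have := (hs₁ t ht).2 hA
      simp [ea] at hat
      omega
  · exact (Finset.card_filter_le _ _).trans (by simp)
  · intro k hk s₃ hF₃ hi ⟨hG, hr⟩
    have hc₃ : s₃.cls = (a, b, c) := by
      rw [← hc]
      simp only [State.cls, hF₃.nat 20 rfl, hF₃.nat 21 rfl, hF₃.nat 22 rfl]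
    refine runs_round (hE₂.of_frame hF₃ rfl) hN hm hM hc₃ ((hF₃.real 27 rfl).trans hσ) hD ?_ hG hr
    intro t ht hA
    by_contra hno
    push Not at hno
    have := hθA t ht hA
    rw [Instance.load, Finset.sum_eq_zero fun j hj => if_neg (hno j (Finset.mem_range.1 hj))] at this
    linarith
  · rintro s₃ hF₃ ⟨⟨C, W, hC, hG⟩, hr⟩
    refine ⟨C, hG.subset, hC, hG.card_mul_le hX hθ.le hθA, fun t ht hA => ?_⟩
    have h0 : s₃.natArr 1 t = 0 := by
      by_contra h0
      have hmem : t ∈ (Finset.range D.M).filter (0 < s₃.natArr 1 ·) :=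
        Finset.mem_filter.2 ⟨Finset.mem_range.2 ht, by omega⟩
      have := Finset.card_pos.2 ⟨t, hmem⟩
      omega
    obtain ⟨j, hj, hjt⟩ := hG.covered t ht hA h0
    exact ⟨j, hj, hjt.2⟩

/-! ### Computing the critical abscissas and the targets -/

/-- The height at `x` of the line through vertices `e` and `e + 1`. -/
noncomputable def lineY (vx vy : ℕ → ℝ) (e : ℕ) (x : ℝ) : ℝ :=
  vy e + (x - vx e) * ((vy (e + 1) - vy e) / (vx (e + 1) - vx e))

/-- The abscissa of the intersection of the line through vertices `e` and `e + 1` with the line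
through guard `j` and vertex `i`. -/
noncomputable def rootX (vx vy gx gy : ℕ → ℝ) (e j i : ℕ) : ℝ :=
  vx e - ((vy e - gy j) * (vx i - gx j) - (vy i - gy j) * (vx e - gx j)) *
    ((vx (e + 1) - vx e) /
      (((vy (e + 1) - gy j) * (vx i - gx j) - (vy i - gy j) * (vx (e + 1) - gx j)) -
        ((vy e - gy j) * (vx i - gx j) - (vy i - gy j) * (vx e - gx j))))

/-- The chain and the guards of `D` are stored in the memory, together with some constants. -/
structure Base (D : Instance) (s : State) : Prop where
  n : s.natVar 0 = D.n
  m : s.natVar 1 = D.m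
  one : s.natVar 2 = 1
  zero : s.natVar 3 = 0
  pred : s.natVar 6 = D.n - 1
  rzero : s.realVar 20 = 0
  vx : s.realArr 0 = D.vx
  vy : s.realArr 1 = D.vy
  gx : s.realArr 2 = D.gx
  gy : s.realArr 3 = D.gy

/-- The program changes none of the locations that hold the chain and the guards. -/
def Prog.avoidsBase (P : Prog) : Bool :=
  P.avoids (0, 0) && P.avoids (0, 1) && P.avoids (0, 2) && P.avoids (0, 3) && P.avoids (0, 6) &&
  P.avoids (1, 20) && P.avoids (3, 0) && P.avoids (3, 1) && P.avoids (3, 2) && P.avoids (3, 3)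

theorem Base.of_frame {D : Instance} {P : Prog} (h : Base D s) (hF : Frame P s s')
    (hP : P.avoidsBase = true) : Base D s' := by
  simp only [Prog.avoidsBase, Bool.and_eq_true] at hP
  obtain ⟨⟨⟨⟨⟨⟨⟨⟨⟨h0, h1⟩, h2⟩, h3⟩, h4⟩, h5⟩, h6⟩, h7⟩, h8⟩, h9⟩ := hP
  exact ⟨(hF.nat _ h0).trans h.n, (hF.nat _ h1).trans h.m, (hF.nat _ h2).trans h.one,
    (hF.nat _ h3).trans h.zero, (hF.nat _ h4).trans h.pred, (hF.real _ h5).trans h.rzero,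
    (hF.realArr _ h6).trans h.vx, (hF.realArr _ h7).trans h.vy, (hF.realArr _ h8).trans h.gx,
    (hF.realArr _ h9).trans h.gy⟩

/-- `x` is one of the numbers listed in array `6`, whose length is variable `5`. -/
def Crit (s : State) (x : ℝ) : Prop := ∃ k < s.natVar 5, s.realArr 6 k = x

theorem Crit.append {x : ℝ} (h5 : s'.natVar 5 = s.natVar 5 + 1)
    (h6 : ∀ k, s'.realArr 6 k = if k = s.natVar 5 then x else s.realArr 6 k) :
    Crit s' x ∧ ∀ y, Crit s y → Crit s' y := by
  refine ⟨⟨s.natVar 5, by omega, by simp [h6]⟩, ?_⟩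
  rintro y ⟨k, hk, rfl⟩
  exact ⟨k, by omega, by rw [h6, if_neg (by omega)]⟩

/-- List the abscissas of the vertices. -/
def vertexP : Prog := forP 12 0 (ops [.realLoad 0 0 12, .realStore 6 5 0, .natAdd 5 5 2])

theorem runs_vertex {D : Instance} {N : ℕ} (h : Base D s) (hN : D.n ≤ N) (h5 : s.natVar 5 = 0) :
    Runs vertexP s (forT N 3)
      (fun s' => s'.natVar 5 = D.n ∧ ∀ i < D.n, Crit s' (D.vx i)) := by
  refine runs_for (L := D.n) (N := N) (τ := 3) (fun k s' => s'.natVar 5 = k ∧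
    ∀ i < k, Crit s' (D.vx i)) h.n hN h.one rfl (by simp [h5]) ?_
  intro k hk s₁ hF₁ hi ⟨hI, hI'⟩
  have hE₁ := h.of_frame hF₁ rfl
  refine runs_ops _ ⟨by simp [hI, hE₁.one], ?_⟩
  have := Crit.append (s := s₁) (s' := (runOps [.realLoad 0 0 12, .realStore 6 5 0, .natAdd 5 5 2]
    s₁).setNat 12 (k + 1)) (x := D.vx k) (by simp [hE₁.one]) (by simp [hE₁.vx, hi])
  intro i hik
  rcases Nat.lt_succ_iff_lt_or_eq.1 hik with hik | rfl
  exacts [this.2 _ (hI' i hik), this.1]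

/-- List the intersection of the line through `(0, 1)` and `(2, 3)` with the line through
`(4, 5)` and vertex `12`. -/
def rootOps : List Instr :=
  [.realLoad 6 0 12, .realLoad 7 1 12,
    .realSub 8 1 5, .realSub 9 6 4, .realMul 8 8 9, .realSub 9 7 5, .realSub 10 0 4,
    .realMul 9 9 10, .realSub 8 8 9,
    .realSub 9 3 5, .realSub 10 6 4, .realMul 9 9 10, .realSub 10 7 5, .realSub 11 2 4,
    .realMul 10 10 11, .realSub 9 9 10,
    .realSub 9 9 8, .realSub 10 2 0, .realDiv 9 10 9, .realMul 8 8 9, .realSub 8 0 8,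
    .realStore 6 5 8, .natAdd 5 5 2]

/-- List the intersections of the lines through edges with the lines through a guard and a
vertex. -/
def rootP : Prog :=
  forP 15 6 (.seq (ops [.natAdd 16 15 2, .realLoad 0 0 15, .realLoad 1 1 15, .realLoad 2 0 16,
    .realLoad 3 1 16])
  (forP 10 1 (.seq (ops [.realLoad 4 2 10, .realLoad 5 3 10]) (forP 12 0 (ops rootOps)))))

/-- The running time of `rootP`. -/
def rootT {R : Type*} [CommSemiring R] (B : R) : R := forT B (5 + forT B (2 + forT B 23))

theorem runs_root {D : Instance} {N : ℕ} (h : Base D s) (hN : D.n ≤ N) (hm : D.m ≤ N) :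
    Runs rootP s (rootT N)
      (fun s' => s'.natVar 5 = s.natVar 5 + (D.n - 1) * (D.m * D.n) ∧
        (∀ x, Crit s x → Crit s' x) ∧
        ∀ e < D.n - 1, ∀ j < D.m, ∀ i < D.n, Crit s' (rootX D.vx D.vy D.gx D.gy e j i)) := by
  refine runs_for (L := D.n - 1) (N := N) (fun k s' =>
    s'.natVar 5 = s.natVar 5 + k * (D.m * D.n) ∧ (∀ x, Crit s x → Crit s' x) ∧
    ∀ e < k, ∀ j < D.m, ∀ i < D.n, Crit s' (rootX D.vx D.vy D.gx D.gy e j i))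
    h.pred (by omega) h.one rfl ⟨by simp, fun x h => h, fun e he => by omega⟩ ?_
  intro e he s₁ hF₁ hi₁ ⟨hI5, hIx, hIr⟩
  have hE₁ := h.of_frame hF₁ rfl
  refine (runs_ops (A := fun s' => s'.realVar 0 = D.vx e ∧ s'.realVar 1 = D.vy e ∧
    s'.realVar 2 = D.vx (e + 1) ∧ s'.realVar 3 = D.vy (e + 1)) _
    (by simp [hE₁.vx, hE₁.vy, hE₁.one, hi₁])).seq ?_
  intro s₂ hF₂ ⟨r0, r1, r2, r3⟩
  have hE₂ := hE₁.of_frame hF₂ rfl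
  have h5₂ := (hF₂.nat 5 rfl).trans hI5
  have hC₂ : ∀ x, Crit s₁ x → Crit s₂ x := fun x hx => by
    rwa [Crit, hF₂.nat 5 rfl, hF₂.realArr 6 rfl]
  refine (runs_for (L := D.m) (N := N) (fun k s' =>
    s'.natVar 5 = s₂.natVar 5 + k * D.n ∧ (∀ x, Crit s₂ x → Crit s' x) ∧
    ∀ j < k, ∀ i < D.n, Crit s' (rootX D.vx D.vy D.gx D.gy e j i))
    hE₂.m hm hE₂.one rfl ⟨by simp, fun x h => by simpa [Crit] using h, fun e he => by omega⟩ ?_).conseq ?_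
  · intro j hj s₃ hF₃ hi₃ ⟨hJ5, hJx, hJr⟩
    have hE₃ := hE₂.of_frame hF₃ rfl
    refine (runs_ops (A := fun s' => s'.realVar 4 = D.gx j ∧ s'.realVar 5 = D.gy j) _
      (by simp [hE₃.gx, hE₃.gy, hi₃])).seq ?_
    intro s₄ hF₄ ⟨r4, r5⟩
    have hE₄ := hE₃.of_frame hF₄ rfl
    have r0₄ := (hF₄.real 0 rfl).trans ((hF₃.real 0 rfl).trans r0)
    have r1₄ := (hF₄.real 1 rfl).trans ((hF₃.real 1 rfl).trans r1)
    have r2₄ := (hF₄.real 2 rfl).trans ((hF₃.real 2 rfl).trans r2)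
    have r3₄ := (hF₄.real 3 rfl).trans ((hF₃.real 3 rfl).trans r3)
    have h5₄ := (hF₄.nat 5 rfl).trans hJ5
    have hC₄ : ∀ x, Crit s₃ x → Crit s₄ x := fun x hx => by
      rwa [Crit, hF₄.nat 5 rfl, hF₄.realArr 6 rfl]
    refine (runs_for (L := D.n) (N := N) (τ := 23) (fun k s' =>
      s'.natVar 5 = s₄.natVar 5 + k ∧ (∀ x, Crit s₄ x → Crit s' x) ∧
      ∀ i < k, Crit s' (rootX D.vx D.vy D.gx D.gy e j i))
      hE₄.n hN hE₄.one rfl ⟨by simp, fun x h => by simpa [Crit] using h, fun e he => by omega⟩ ?_).conseq ?_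
    · intro i hi s₅ hF₅ hi₅ ⟨hK5, hKx, hKr⟩
      have hE₅ := hE₄.of_frame hF₅ rfl
      have hap := Crit.append (s := s₅) (s' := (runOps rootOps s₅).setNat 12 (i + 1))
        (x := rootX D.vx D.vy D.gx D.gy e j i) (by simp [rootOps, hE₅.one])
        (by
          intro k
          simp only [rootOps, runOps, Instr.run, State.setReal, State.setNat, State.setRealArr]
          by_cases hk : k = s₅.natVar 5 <;>
            simp [hk, hi₅, hE₅.vx, hE₅.vy, rootX, (hF₅.real 0 rfl).trans r0₄,
              (hF₅.real 1 rfl).trans r1₄, (hF₅.real 2 rfl).trans r2₄, (hF₅.real 3 rfl).trans r3₄,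
              (hF₅.real 4 rfl).trans r4, (hF₅.real 5 rfl).trans r5])
      refine runs_ops _ ⟨by simp [rootOps, hE₅.one, hK5, add_assoc],
        fun x hx => hap.2 x (hKx x hx), fun i' hi' => ?_⟩
      rcases Nat.lt_succ_iff_lt_or_eq.1 hi' with hi' | rfl
      exacts [hap.2 _ (hKr i' hi'), hap.1]
    · rintro s₅ hF₅ ⟨hK5, hKx, hKr⟩
      refine ⟨?_, fun x hx => hKx x (hC₄ x (hJx x hx)), fun j' hj' i hi => ?_⟩
      · simp [hK5, h5₄]; ring
      · rcases Nat.lt_succ_iff_lt_or_eq.1 hj' with hj' | rfl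
        exacts [hKx _ (hC₄ _ (hJr j' hj' i hi)), hKr i hi]
  · rintro s₃ hF₃ ⟨hJ5, hJx, hJr⟩
    refine ⟨?_, fun x hx => hJx x (hC₂ x (hIx x hx)), fun e' he' j hj i hi => ?_⟩
    · simp [hJ5, h5₂]; ring
    · rcases Nat.lt_succ_iff_lt_or_eq.1 he' with he' | rfl
      exacts [hJx _ (hC₂ _ (hIr e' he' j hj i hi)), hJr j hj i hi]

/-- `(x, y)` is one of the targets listed in arrays `4` and `5`. -/
def Target (s : State) (x y : ℝ) : Prop :=
  ∃ k < s.natVar 4, s.realArr 4 k = x ∧ s.realArr 5 k = y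

/-- All targets lie on the chain. -/
def Sound (D : Instance) (s : State) : Prop :=
  ∀ x y, Target s x y → x = D.vx 0 ∧ y = D.vy 0 ∨
    ∃ e < D.n - 1, D.vx e ≤ x ∧ x ≤ D.vx (e + 1) ∧ y = lineY D.vx D.vy e x

theorem Target.append {x y : ℝ} (h4 : s'.natVar 4 = s.natVar 4 + 1)
    (hx : ∀ k, s'.realArr 4 k = if k = s.natVar 4 then x else s.realArr 4 k)
    (hy : ∀ k, s'.realArr 5 k = if k = s.natVar 4 then y else s.realArr 5 k) :
    ∀ x' y', Target s' x' y' ↔ Target s x' y' ∨ x' = x ∧ y' = y := by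
  intro x' y'
  constructor
  · rintro ⟨k, hk, h1, h2⟩
    rw [hx] at h1
    rw [hy] at h2
    split_ifs at h1 h2
    · exact Or.inr ⟨h1.symm, h2.symm⟩
    · exact Or.inl ⟨k, by omega, h1, h2⟩
  · rintro (⟨k, hk, rfl, rfl⟩ | ⟨rfl, rfl⟩)
    · exact ⟨k, by omega, by rw [hx, if_neg (by omega)], by rw [hy, if_neg (by omega)]⟩
    · exact ⟨s.natVar 4, by omega, by rw [hx, if_pos rfl], by rw [hy, if_pos rfl]⟩

/-- Make the point at the middle of abscissas `4` and `18` a target if it lies on the edge from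
`(0, 1)` to `(2, 3)`. -/
def middleP : Prog :=
  .seq (ops [.realLoad 5 6 18, .realAdd 6 4 5, .realDiv 6 6 10])
  (.branch (.realLe 0 6) (.branch (.realLe 6 2)
    (ops [.realSub 7 6 0, .realSub 8 3 1, .realSub 9 2 0, .realDiv 8 8 9, .realMul 7 7 8,
      .realAdd 7 1 7, .realStore 4 4 6, .realStore 5 4 7, .natAdd 4 4 2]) .skip) .skip)

theorem runs_middle {D : Instance} {e b : ℕ} {x : ℝ} (h : Base D s) (he : e < D.n - 1)
    (r0 : s.realVar 0 = D.vx e) (r1 : s.realVar 1 = D.vy e) (r2 : s.realVar 2 = D.vx (e + 1))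
    (r3 : s.realVar 3 = D.vy (e + 1)) (r4 : s.realVar 4 = x) (r10 : s.realVar 10 = 2)
    (hb : s.natVar 18 = b) (hS : Sound D s) :
    Runs middleP s 14 (fun s' => s'.natVar 4 ≤ s.natVar 4 + 1 ∧ Sound D s' ∧
      (∀ x y, Target s x y → Target s' x y) ∧
      (D.vx e ≤ (x + s.realArr 6 b) / 2 → (x + s.realArr 6 b) / 2 ≤ D.vx (e + 1) →
        Target s' ((x + s.realArr 6 b) / 2) (lineY D.vx D.vy e ((x + s.realArr 6 b) / 2)))) := by
  refine (runs_ops (A := fun s' => s'.realVar 6 = (x + s.realArr 6 b) / 2) _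
    (by simp [r4, r10, hb])).seq (υ := 11) ?_
  intro s₁ hF₁ r6
  have hE₁ := h.of_frame hF₁ rfl
  have h4 := hF₁.nat 4 rfl
  have hT : ∀ x y, Target s₁ x y ↔ Target s x y := fun x y => by
    rw [Target, h4, hF₁.realArr 4 rfl, hF₁.realArr 5 rfl, Target]
  have hS₁ : Sound D s₁ := fun x y hxy => hS x y ((hT x y).1 hxy)
  generalize (x + s.realArr 6 b) / 2 = z at *
  have r0₁ := (hF₁.real 0 rfl).trans r0
  have r1₁ := (hF₁.real 1 rfl).trans r1
  have r2₁ := (hF₁.real 2 rfl).trans r2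
  have r3₁ := (hF₁.real 3 rfl).trans r3
  refine runs_branch (τ := 10) (fun hd => ?_) (fun hd => ?_) <;>
    simp only [Cond.Holds, r0₁, r6] at hd
  · refine runs_branch (τ := 9) (fun hd' => ?_) (fun hd' => ?_) <;>
      simp only [Cond.Holds, r2₁, r6] at hd'
    · refine runs_ops _ ?_
      have hap := Target.append (s := s₁) (s' := runOps [.realSub 7 6 0, .realSub 8 3 1,
        .realSub 9 2 0, .realDiv 8 8 9, .realMul 7 7 8,
        .realAdd 7 1 7, .realStore 4 4 6, .realStore 5 4 7, .natAdd 4 4 2] s₁) (x := z)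
        (y := lineY D.vx D.vy e z) (by simp [hE₁.one]) (by simp [r6])
        (by simp [r6, r0₁, r1₁, r2₁, r3₁, lineY])
      refine ⟨by simp [hE₁.one, h4], fun x y hxy => ?_, fun x y hxy => ?_, fun _ _ => ?_⟩
      · rcases (hap x y).1 hxy with hxy | ⟨rfl, rfl⟩
        · exact hS₁ x y hxy
        · exact Or.inr ⟨e, he, hd, hd', rfl⟩
      · exact (hap x y).2 (Or.inl ((hT x y).2 hxy))
      · exact (hap _ _).2 (Or.inr ⟨rfl, rfl⟩)
    · exact (runs_skip ⟨by omega, hS₁, fun x y hxy => (hT x y).2 hxy,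
        fun _ h => (hd' h).elim⟩).mono (by omega) (fun _ _ h => h)
  · exact (runs_skip ⟨by omega, hS₁, fun x y hxy => (hT x y).2 hxy,
      fun h => (hd h).elim⟩).mono (by omega) (fun _ _ h => h)

/-- List the targets. -/
def targetP : Prog :=
  -- The first vertex is listed separately because a chain with a single vertex has no edge and
  -- hence no middles.
  .seq (ops [.realLoad 0 0 3, .realStore 4 4 0, .realLoad 0 1 3, .realStore 5 4 0, .natAdd 4 4 2])
  (forP 15 6 (.seq (ops [.natAdd 16 15 2, .realLoad 0 0 15, .realLoad 1 1 15, .realLoad 2 0 16,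
    .realLoad 3 1 16, .realConst 10 2])
  (forP 17 5 (.seq (ops [.realLoad 4 6 17]) (forP 18 5 middleP)))))

/-- The running time of `targetP`. -/
def targetT {R : Type*} [CommSemiring R] (B : R) : R :=
  5 + forT B (6 + forT B (1 + forT B 14))

/-- If the middle of abscissas `x` and `y` lies on edge `e`, then it is a target. -/
def MiddleTarget (D : Instance) (s : State) (e : ℕ) (x y : ℝ) : Prop :=
  D.vx e ≤ (x + y) / 2 → (x + y) / 2 ≤ D.vx (e + 1) →
    Target s ((x + y) / 2) (lineY D.vx D.vy e ((x + y) / 2))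

theorem runs_target {D : Instance} {N : ℕ} (h : Base D s) (hN : D.n ≤ N) (h5 : s.natVar 5 ≤ N)
    (h4 : s.natVar 4 = 0) :
    Runs targetP s (targetT N) (fun s' =>
      s'.natVar 4 ≤ 1 + (D.n - 1) * (s.natVar 5 * s.natVar 5) ∧ Sound D s' ∧
      Target s' (D.vx 0) (D.vy 0) ∧
      ∀ e < D.n - 1, ∀ x y, Crit s x → Crit s y → MiddleTarget D s' e x y) := by
  refine (runs_ops (A := fun s' => s'.natVar 4 = 1 ∧ Sound D s' ∧
    Target s' (D.vx 0) (D.vy 0)) _ ?_).seq ?_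
  · have hap := Target.append (s := s) (s' := runOps [.realLoad 0 0 3, .realStore 4 4 0,
      .realLoad 0 1 3, .realStore 5 4 0, .natAdd 4 4 2] s) (x := D.vx 0) (y := D.vy 0)
      (by simp [h.one]) (by simp [h.zero, h.vx]) (by simp [h.zero, h.vy])
    refine ⟨by simp [h.one, h4], fun x y hxy => ?_, (hap _ _).2 (Or.inr ⟨rfl, rfl⟩)⟩
    rcases (hap x y).1 hxy with ⟨k, hk, -⟩ | hxy
    · omega
    · exact Or.inl hxy
  intro s₁ hF₁ ⟨h4₁, hS₁, hT₁⟩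
  have hE₁ := h.of_frame hF₁ rfl
  have h5₁ := hF₁.nat 5 rfl
  have h6₁ := hF₁.realArr 6 rfl
  refine (runs_for (L := D.n - 1) (N := N) (fun k s' =>
    s'.natVar 4 ≤ 1 + k * (s.natVar 5 * s.natVar 5) ∧ Sound D s' ∧
    (∀ x y, Target s₁ x y → Target s' x y) ∧
    ∀ e < k, ∀ x y, Crit s x → Crit s y → MiddleTarget D s' e x y)
    hE₁.pred (by omega) hE₁.one rfl
    (by exact ⟨by simp [h4₁], hS₁, fun x y h => h, fun e he => by omega⟩) ?_).conseq ?_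
  swap
  · rintro s₂ - ⟨h1, h2, h3, h4⟩
    exact ⟨h1, h2, h3 _ _ hT₁, h4⟩
  intro e he s₂ hF₂ hi₂ ⟨hI4, hIS, hIT, hIM⟩
  have hE₂ := hE₁.of_frame hF₂ rfl
  refine (runs_ops (A := fun s' => s'.realVar 0 = D.vx e ∧ s'.realVar 1 = D.vy e ∧
    s'.realVar 2 = D.vx (e + 1) ∧ s'.realVar 3 = D.vy (e + 1) ∧ s'.realVar 10 = 2) _
    (by simp [hE₂.vx, hE₂.vy, hE₂.one, hi₂])).seq ?_
  intro s₃ hF₃ ⟨r0, r1, r2, r3, r10⟩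
  have hE₃ := hE₂.of_frame hF₃ rfl
  have h4₃ := hF₃.nat 4 rfl
  have h5₃ := (hF₃.nat 5 rfl).trans ((hF₂.nat 5 rfl).trans h5₁)
  have h6₃ := (hF₃.realArr 6 rfl).trans ((hF₂.realArr 6 rfl).trans h6₁)
  have hT₃ : ∀ x y, Target s₃ x y ↔ Target s₂ x y := fun x y => by
    rw [Target, h4₃, hF₃.realArr 4 rfl, hF₃.realArr 5 rfl, Target]
  have hS₃ : Sound D s₃ := fun x y hxy => hIS x y ((hT₃ x y).1 hxy)
  refine (runs_for (L := s.natVar 5) (N := N) (fun k s' =>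
    s'.natVar 4 ≤ s₃.natVar 4 + k * s.natVar 5 ∧ Sound D s' ∧
    (∀ x y, Target s₃ x y → Target s' x y) ∧
    ∀ a < k, ∀ y, Crit s y → MiddleTarget D s' e (s.realArr 6 a) y)
    h5₃ h5 hE₃.one rfl
    (by exact ⟨by simp, hS₃, fun x y h => h, fun e he => by omega⟩) ?_).conseq ?_
  swap
  · rintro s₄ - ⟨h1, h2, h3, h4⟩
    refine ⟨?_, h2, fun x y h => h3 x y ((hT₃ x y).2 (hIT x y h)), fun e' he' x y hx hy hl hr => ?_⟩
    · have : (e + 1) * (s.natVar 5 * s.natVar 5) =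
        e * (s.natVar 5 * s.natVar 5) + s.natVar 5 * s.natVar 5 := by ring
      simp
      omega
    · rcases Nat.lt_succ_iff_lt_or_eq.1 he' with he' | rfl
      · exact h3 _ _ ((hT₃ _ _).2 (hIM e' he' x y hx hy hl hr))
      · obtain ⟨a, ha, rfl⟩ := hx
        exact h4 a ha y hy hl hr
  intro a ha s₄ hF₄ hi₄ ⟨hJ4, hJS, hJT, hJM⟩
  have hE₄ := hE₃.of_frame hF₄ rfl
  refine (runs_ops (A := fun s' => s'.realVar 4 = s.realArr 6 a) _
    (by simp [(hF₄.realArr 6 rfl).trans h6₃, hi₄])).seq ?_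
  intro s₅ hF₅ r4
  have hE₅ := hE₄.of_frame hF₅ rfl
  have h4₅ := hF₅.nat 4 rfl
  have h5₅ := (hF₅.nat 5 rfl).trans ((hF₄.nat 5 rfl).trans h5₃)
  have h6₅ := (hF₅.realArr 6 rfl).trans ((hF₄.realArr 6 rfl).trans h6₃)
  have hT₅ : ∀ x y, Target s₅ x y ↔ Target s₄ x y := fun x y => by
    rw [Target, h4₅, hF₅.realArr 4 rfl, hF₅.realArr 5 rfl, Target]
  have hS₅ : Sound D s₅ := fun x y hxy => hJS x y ((hT₅ x y).1 hxy)
  have r0₅ := (hF₅.real 0 rfl).trans ((hF₄.real 0 rfl).trans r0)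
  have r1₅ := (hF₅.real 1 rfl).trans ((hF₄.real 1 rfl).trans r1)
  have r2₅ := (hF₅.real 2 rfl).trans ((hF₄.real 2 rfl).trans r2)
  have r3₅ := (hF₅.real 3 rfl).trans ((hF₄.real 3 rfl).trans r3)
  have r10₅ := (hF₅.real 10 rfl).trans ((hF₄.real 10 rfl).trans r10)
  refine (runs_for (L := s.natVar 5) (N := N) (fun k s' =>
    s'.natVar 4 ≤ s₅.natVar 4 + k ∧ Sound D s' ∧
    (∀ x y, Target s₅ x y → Target s' x y) ∧
    ∀ b < k, MiddleTarget D s' e (s.realArr 6 a) (s.realArr 6 b))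
    h5₅ h5 hE₅.one rfl
    (by exact ⟨by simp, hS₅, fun x y h => h, fun e he => by omega⟩) ?_).conseq ?_
  swap
  · rintro s₆ - ⟨h1, h2, h3, h4⟩
    refine ⟨?_, h2, fun x y h => h3 x y ((hT₅ x y).2 (hJT x y h)), fun a' ha' y hy hl hr => ?_⟩
    · have : (a + 1) * s.natVar 5 = a * s.natVar 5 + s.natVar 5 := by ring
      simp
      omega
    · rcases Nat.lt_succ_iff_lt_or_eq.1 ha' with ha' | rfl
      · exact h3 _ _ ((hT₅ _ _).2 (hJM a' ha' y hy hl hr))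
      · obtain ⟨b, hb, rfl⟩ := hy
        exact h4 b hb hl hr
  intro b hb s₆ hF₆ hi₆ ⟨hK4, hKS, hKT, hKM⟩
  have hE₆ := hE₅.of_frame hF₆ rfl
  have h6₆ := (hF₆.realArr 6 rfl).trans h6₅
  refine (runs_middle hE₆ he ((hF₆.real 0 rfl).trans r0₅) ((hF₆.real 1 rfl).trans r1₅)
    ((hF₆.real 2 rfl).trans r2₅) ((hF₆.real 3 rfl).trans r3₅) ((hF₆.real 4 rfl).trans r4)
    ((hF₆.real 10 rfl).trans r10₅) hi₆ hKS).conseq ?_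
  rintro s₇ - ⟨h1, h2, h3, h4⟩
  rw [h6₆] at h4
  refine ⟨by simp; omega, h2, fun x y h => h3 x y (hKT x y h), fun b' hb' => ?_⟩
  rcases Nat.lt_succ_iff_lt_or_eq.1 hb' with hb' | rfl
  · exact fun hl hr => h3 _ _ (hKM b' hb' hl hr)
  · exact h4

end RealRAM

namespace ChainGuard
open RealRAM

/-! ### Geometry of visibility on the graph of a piecewise linear function -/

/-- `f` is the piecewise linear function through the points `(X i, Y i)`, `i < n`. -/
structure IsHeight (n : ℕ) (X Y : ℕ → ℝ) (f : ℝ → ℝ) : Prop where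
  lt : ∀ e < n - 1, X e < X (e + 1)
  vertex : ∀ i < n, f (X i) = Y i
  edge : ∀ e < n - 1, ∀ x, X e ≤ x → x ≤ X (e + 1) → f x = lineY X Y e x

/-- The piecewise linear function through the points `(X i, Y i)`, `i ≤ k`. -/
noncomputable def height (X Y : ℕ → ℝ) : ℕ → ℝ → ℝ
  | 0, _ => Y 0
  | k + 1, x => open Classical in if x ≤ X k then height X Y k x else lineY X Y k x

theorem le_of_lt_succ {X : ℕ → ℝ} {k : ℕ} (h : ∀ e < k, X e < X (e + 1)) {i : ℕ} (hi : i ≤ k) :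
    X i ≤ X k := by
  induction k with
  | zero => rw [Nat.le_zero.1 hi]
  | succ k ih =>
    rcases Nat.le_succ_iff.1 hi with hi | rfl
    · exact (ih (fun e he => h e (by omega)) hi).trans (h k (by omega)).le
    · exact le_rfl

theorem height_vertex {X Y : ℕ → ℝ} {k : ℕ} (h : ∀ e < k, X e < X (e + 1)) {i : ℕ} (hi : i ≤ k) :
    height X Y k (X i) = Y i := by
  induction k with
  | zero => rw [Nat.le_zero.1 hi, height]
  | succ k ih =>
    have h' : ∀ e < k, X e < X (e + 1) := fun e he => h e (by omega)
    rcases Nat.le_succ_iff.1 hi with hi | rfl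
    · rw [height, if_pos (le_of_lt_succ h' hi), ih h' hi]
    · have hk := h k (by omega)
      rw [height, if_neg (not_le.2 hk), lineY, mul_div_cancel₀ _ (sub_pos.2 hk).ne']
      ring

theorem height_edge {X Y : ℕ → ℝ} {k : ℕ} (h : ∀ e < k, X e < X (e + 1)) {e : ℕ} (he : e < k)
    {x : ℝ} (hl : X e ≤ x) (hr : x ≤ X (e + 1)) : height X Y k x = lineY X Y e x := by
  induction k with
  | zero => omega
  | succ k ih =>
    have h' : ∀ e < k, X e < X (e + 1) := fun e he => h e (by omega)
    rcases Nat.lt_succ_iff_lt_or_eq.1 he with he | rfl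
    · rw [height, if_pos (hr.trans (le_of_lt_succ h' he)), ih h' he]
    · rw [height]
      split_ifs with hx
      · rw [le_antisymm hx hl, height_vertex h' le_rfl, lineY]
        ring
      · rfl

theorem isHeight_height {n : ℕ} {X Y : ℕ → ℝ} (h : ∀ e < n - 1, X e < X (e + 1)) :
    IsHeight n X Y (height X Y (n - 1)) where
  lt := h
  vertex i hi := height_vertex h (by omega)
  edge e he x hl hr := height_edge h he hl hr

theorem exists_edge {X : ℕ → ℝ} {k : ℕ} (hk : 0 < k) {x : ℝ} (h0 : X 0 ≤ x) (h1 : x ≤ X k) :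
    ∃ e < k, X e ≤ x ∧ x ≤ X (e + 1) := by
  induction k with
  | zero => omega
  | succ k ih =>
    by_cases hx : x ≤ X k
    · rcases Nat.eq_zero_or_pos k with rfl | hk'
      · exact ⟨0, by omega, h0, h1⟩
      · obtain ⟨e, he, h⟩ := ih hk' hx
        exact ⟨e, by omega, h⟩
    · exact ⟨k, by omega, (not_le.1 hx).le, h1⟩

/-- No vertex hides the point of the chain at `x` from the point of the chain at `a`. -/
def Clear (n : ℕ) (X Y : ℕ → ℝ) (f : ℝ → ℝ) (a x : ℝ) : Prop :=
  ∀ i < n, ¬ ((a < X i ∧ X i < x ∧ (f x - f a) * (X i - a) - (Y i - f a) * (x - a) < 0) ∨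
    (x < X i ∧ X i < a ∧ 0 < (f x - f a) * (X i - a) - (Y i - f a) * (x - a)))

/-- Between `a` and `c` the graph of `f` lies below the chord. -/
def BelowChord (f : ℝ → ℝ) (a c : ℝ) : Prop :=
  ∀ x, a ≤ x → x ≤ c → (f x - f a) * (c - a) ≤ (f c - f a) * (x - a)

theorem clear_comm {n : ℕ} {X Y : ℕ → ℝ} {f : ℝ → ℝ} {a c : ℝ} (h : Clear n X Y f a c) :
    Clear n X Y f c a := by
  intro i hi hh
  refine h i hi ?_
  rcases hh with ⟨h1, h2, h3⟩ | ⟨h1, h2, h3⟩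
  · exact Or.inr ⟨h1, h2, by linarith⟩
  · exact Or.inl ⟨h1, h2, by linarith⟩

theorem affine_nonneg {α β l r x : ℝ} (hl : 0 ≤ α + β * l) (hr : 0 ≤ α + β * r) (hlx : l ≤ x)
    (hxr : x ≤ r) : 0 ≤ α + β * x := by
  rcases le_total 0 β with hβ | hβ
  · nlinarith [mul_le_mul_of_nonneg_left hlx hβ]
  · nlinarith [mul_le_mul_of_nonpos_left hxr hβ]

/-- On the part of an edge above `[a, c]`, chord minus `f`, scaled by `c - a`, is affine. Its
nonnegativity follows from the two ends, each of which is a vertex or an end of the chord. This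
reduces visibility to the finitely many sign tests that the machine performs. -/
theorem clear_iff_belowChord {n : ℕ} {X Y : ℕ → ℝ} {f : ℝ → ℝ} (hf : IsHeight n X Y f) {a c : ℝ}
    (hac : a < c) (ha : X 0 ≤ a) (hc : c ≤ X (n - 1)) :
    Clear n X Y f a c ↔ BelowChord f a c := by
  constructor
  · intro h x hax hxc
    have hn : 0 < n - 1 := by
      rcases Nat.eq_zero_or_pos (n - 1) with h0 | h0
      · rw [h0] at hc; linarith
      · exact h0
    obtain ⟨e, he, hl, hr⟩ := exists_edge hn (ha.trans hax) (hxc.trans hc)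
    have hv : ∀ i < n, a ≤ X i → X i ≤ c →
        0 ≤ (f c - f a) * (X i - a) - (f (X i) - f a) * (c - a) := by
      intro i hi h1 h2
      rcases h1.eq_or_lt with h1 | h1
      · rw [← h1]; simp
      rcases h2.eq_or_lt with h2 | h2
      · rw [h2]; simp
      by_contra h3
      rw [hf.vertex i hi] at h3
      exact h i hi (Or.inl ⟨h1, h2, not_le.1 h3⟩)
    set σ := (Y (e + 1) - Y e) / (X (e + 1) - X e) with hσ
    have hlin : ∀ z, X e ≤ z → z ≤ X (e + 1) →
        (f c - f a) * (z - a) - (f z - f a) * (c - a) =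
        (-(f c - f a) * a - (Y e - X e * σ - f a) * (c - a)) +
          ((f c - f a) - σ * (c - a)) * z := by
      intro z h1 h2
      rw [hf.edge e he z h1 h2, lineY, ← hσ]
      ring
    have key : 0 ≤ (f c - f a) * (x - a) - (f x - f a) * (c - a) := by
      rw [hlin x hl hr]
      refine affine_nonneg (l := max (X e) a) (r := min (X (e + 1)) c) ?_ ?_
        (max_le hl hax) (le_min hr hxc)
      · rw [← hlin _ (le_max_left _ _) (max_le (hf.lt e he).le (hax.trans hr))]
        rcases max_cases (X e) a with ⟨h1, h2⟩ | ⟨h1, h2⟩ <;> rw [h1]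
        · exact hv e (by omega) h2 (hl.trans hxc)
        · simp
      · rw [← hlin _ (le_min (hf.lt e he).le (hl.trans hxc)) (min_le_left _ _)]
        rcases min_cases (X (e + 1)) c with ⟨h1, h2⟩ | ⟨h1, h2⟩ <;> rw [h1]
        · exact hv (e + 1) (by omega) (hax.trans hr) h2
        · simp
    linarith
  · rintro h i hi (⟨h1, h2, h3⟩ | ⟨h1, h2, -⟩)
    · have := h (X i) h1.le h2.le
      rw [hf.vertex i hi] at this
      linarith
    · linarith

/-- The order claim for visibility on a terrain. -/
theorem BelowChord.cross {f : ℝ → ℝ} {a b c d : ℝ} (hab : a < b) (hbc : b < c) (hcd : c < d)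
    (h₁ : BelowChord f a c) (h₂ : BelowChord f b d) : BelowChord f a d := by
  have slope : ∀ {u v : ℝ}, u < v → ∃ μ, f v = f u + μ * (v - u) := fun {u v} huv =>
    ⟨(f v - f u) / (v - u), by rw [div_mul_cancel₀ _ (sub_pos.2 huv).ne']; ring⟩
  have below : ∀ {u v μ : ℝ}, u < v → f v = f u + μ * (v - u) → BelowChord f u v →
      ∀ x, u ≤ x → x ≤ v → f x ≤ f u + μ * (x - u) := by
    intro u v μ huv hμ h x h1 h2
    have := h x h1 h2
    rw [hμ] at this
    have h3 : (f x - f u) * (v - u) ≤ (μ * (x - u)) * (v - u) := by linarith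
    linarith [le_of_mul_le_mul_right h3 (sub_pos.2 huv)]
  obtain ⟨p, hp⟩ := slope (hab.trans hbc)
  obtain ⟨q, hq⟩ := slope (hbc.trans hcd)
  obtain ⟨r, hr⟩ := slope (hab.trans (hbc.trans hcd))
  have b1 := below (hab.trans hbc) hp h₁
  have b2 := below (hbc.trans hcd) hq h₂
  have e1 := b1 b hab.le hbc.le
  have e2 := b2 c hbc.le hcd.le
  -- Here `p`, `q`, `r` are the slopes of the chords over `[a, c]`, `[b, d]`, `[a, d]`. As `b` lies
  -- below the first chord and `c` below the second, the slope from `b` to `c` lies between `p` and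
  -- `q`. It follows that `p ≤ r ≤ q`, so the chord over `[a, d]` is above the first chord on `[a,
  -- c]` and above the second on `[c, d]`.
  have hpq : p ≤ q := by
    have : p * (c - b) ≤ q * (c - b) := by linarith
    exact le_of_mul_le_mul_right this (sub_pos.2 hbc)
  have hpr : p ≤ r := by
    have h3 := mul_le_mul_of_nonneg_right hpq (sub_pos.2 hcd).le
    have : p * (d - a) ≤ r * (d - a) := by linarith
    exact le_of_mul_le_mul_right this (by linarith)
  have hrq : r ≤ q := by
    have h3 := mul_le_mul_of_nonneg_right hpq (sub_pos.2 hab).le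
    have : r * (d - a) ≤ q * (d - a) := by linarith
    exact le_of_mul_le_mul_right this (by linarith)
  intro x hax hxd
  have key : f x ≤ f a + r * (x - a) := by
    rcases le_total x c with hxc | hxc
    · have := b1 x hax hxc
      have := mul_le_mul_of_nonneg_right hpr (sub_nonneg.2 hax)
      linarith
    · have := b2 x (hbc.le.trans hxc) hxd
      have := mul_le_mul_of_nonneg_right hrq (sub_nonneg.2 hxd)
      linarith
  rw [hr]
  have := mul_le_mul_of_nonneg_right (sub_le_iff_le_add'.2 key)
    (sub_pos.2 (hab.trans (hbc.trans hcd))).le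
  linarith

theorem Clear.cross {n : ℕ} {X Y : ℕ → ℝ} {f : ℝ → ℝ} (hf : IsHeight n X Y f) {a b c d : ℝ}
    (ha : X 0 ≤ a) (hab : a ≤ b) (hbc : b < c) (hcd : c ≤ d) (hd : d ≤ X (n - 1))
    (h₁ : Clear n X Y f a c) (h₂ : Clear n X Y f b d) : Clear n X Y f a d := by
  rcases hab.eq_or_lt with rfl | hab
  · exact h₂
  rcases hcd.eq_or_lt with rfl | hcd
  · exact h₁
  rw [clear_iff_belowChord hf (by linarith) (by linarith) (by linarith)] at h₁ h₂ ⊢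
  exact h₁.cross hab hbc hcd h₂

/-- If every middle of two critical abscissas is seen by one of the guards at `g j`, `j ∈ H`, then
so is every point of the chain. -/
theorem exists_clear_of_middles {n : ℕ} {X Y : ℕ → ℝ} {f : ℝ → ℝ} (hf : IsHeight n X Y f)
    {H : Finset ℕ} {g : ℕ → ℝ} {S : Set ℝ} (hS : S.Finite) (hn : 0 < n) (hX : ∀ i < n, X i ∈ S)
    (hr : ∀ e < n - 1, ∀ j ∈ H, ∀ i < n, rootX X Y g (fun j => f (g j)) e j i ∈ S)
    (h0 : ∃ j ∈ H, Clear n X Y f (g j) (X 0))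
    (hmid : ∀ e < n - 1, ∀ x ∈ S, ∀ y ∈ S, X e ≤ (x + y) / 2 → (x + y) / 2 ≤ X (e + 1) →
      ∃ j ∈ H, Clear n X Y f (g j) ((x + y) / 2))
    {x : ℝ} (hx0 : X 0 ≤ x) (hx1 : x ≤ X (n - 1)) : ∃ j ∈ H, Clear n X Y f (g j) x := by
  rcases Nat.eq_zero_or_pos (n - 1) with hn1 | hn1
  · rw [hn1] at hx1
    rwa [le_antisymm hx1 hx0]
  obtain ⟨e, he, hl, hr'⟩ := exists_edge hn1 hx0 hx1
  by_cases hxS : x ∈ S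
  · have hxx : (x + x) / 2 = x := by ring
    have := hmid e he x hxS x hxS
    rw [hxx] at this
    exact this hl hr'
  have hne : ∀ y ∈ S, y ≠ x := fun y hy h => hxS (h ▸ hy)
  have hel := lt_of_le_of_ne hl (hne _ (hX e (by omega)))
  have her := lt_of_le_of_ne hr' (hne _ (hX (e + 1) (by omega))).symm
  -- `l` and `r` are the critical abscissas next to `x`. They lie within the edge because its two
  -- vertices are critical. A guard that sees their middle turns out to see `x`.
  obtain ⟨l, ⟨hlS, hlx⟩, hlmax⟩ := Set.exists_max_image {y | y ∈ S ∧ y < x} id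
    (hS.subset fun y hy => hy.1) ⟨X e, hX e (by omega), hel⟩
  obtain ⟨r, ⟨hrS, hrx⟩, hrmin⟩ := Set.exists_min_image {y | y ∈ S ∧ x < y} id
    (hS.subset fun y hy => hy.1) ⟨X (e + 1), hX (e + 1) (by omega), her⟩
  have hlmax' : ∀ y ∈ S, y < x → y ≤ l := fun y h1 h2 => hlmax y ⟨h1, h2⟩
  have hrmin' : ∀ y ∈ S, x < y → r ≤ y := fun y h1 h2 => hrmin y ⟨h1, h2⟩
  have hle := hlmax' _ (hX e (by omega)) hel
  have hre := hrmin' _ (hX (e + 1) (by omega)) her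
  have hm1 : l < (l + r) / 2 := by linarith
  have hm2 : (l + r) / 2 < r := by linarith
  obtain ⟨j, hj, hclear⟩ := hmid e he l hlS r hrS (by linarith) (by linarith)
  refine ⟨j, hj, ?_⟩
  generalize (l + r) / 2 = z at *
  have hw : 0 < X (e + 1) - X e := sub_pos.2 (hf.lt e he)
  -- Along the edge the test for vertex `i` is an affine function of the abscissa: either constant,
  -- or `κ * (u - ρ)` with a critical root `ρ`. In the constant case the division by zero in `rootX`
  -- yields the abscissa of vertex `e`, a harmless extra element of `S`.
  have key : ∀ i < n, ∃ κ ρ, ρ ∈ S ∧ (κ = 0 ∧ ((f z - f (g j)) * (X i - g j) -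
      (Y i - f (g j)) * (z - g j) = (f x - f (g j)) * (X i - g j) - (Y i - f (g j)) * (x - g j)) ∨
      (f z - f (g j)) * (X i - g j) - (Y i - f (g j)) * (z - g j) = κ * (z - ρ) ∧
      (f x - f (g j)) * (X i - g j) - (Y i - f (g j)) * (x - g j) = κ * (x - ρ)) := by
    intro i hi
    have hfz : f z = lineY X Y e z := hf.edge e he z (by linarith) (by linarith)
    have hfx : f x = lineY X Y e x := hf.edge e he x hl hr'
    set dA := (Y e - f (g j)) * (X i - g j) - (Y i - f (g j)) * (X e - g j) with hdA
    set dB := (Y (e + 1) - f (g j)) * (X i - g j) - (Y i - f (g j)) * (X (e + 1) - g j) with hdB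
    have hlin : ∀ u, (lineY X Y e u - f (g j)) * (X i - g j) - (Y i - f (g j)) * (u - g j) =
        dA + (dB - dA) / (X (e + 1) - X e) * (u - X e) := by
      intro u
      rw [hdA, hdB, lineY]
      field_simp
      ring
    refine ⟨(dB - dA) / (X (e + 1) - X e), _, hr e he j hj i hi, ?_⟩
    rw [hfz, hfx, hlin, hlin]
    rcases eq_or_ne (dB - dA) 0 with h | h
    · left; simp [h]
    · right
      have : rootX X Y g (fun j => f (g j)) e j i =
          X e - dA * ((X (e + 1) - X e) / (dB - dA)) := rfl
      rw [this]
      constructor <;> field_simp <;> ring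
  intro i hi hH
  obtain ⟨κ, ρ, hρ, hκ⟩ := key i hi
  have hρx := hne ρ hρ
  rcases hH with ⟨h1, h2, h3⟩ | ⟨h1, h2, h3⟩
  -- No vertex lies strictly between `l` and `r`, so one that is between the guard and `x` is also
  -- between the guard and `z`. No root lies there either, so the tests at `x` and `z` cannot have
  -- opposite signs.
  · have h4 := hlmax' _ (hX i hi) h2
    have h5 : 0 ≤ (f z - f (g j)) * (X i - g j) - (Y i - f (g j)) * (z - g j) := by
      by_contra h5
      exact hclear i hi (Or.inl ⟨h1, by linarith, not_le.1 h5⟩)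
    rcases hκ with ⟨-, h6⟩ | ⟨h6, h7⟩
    · linarith
    rw [h6] at h5
    rw [h7] at h3
    rcases lt_or_gt_of_ne hρx with hρx | hρx
    · have := hlmax' ρ hρ hρx
      have : κ < 0 := by by_contra h; nlinarith
      nlinarith
    · have := hrmin' ρ hρ hρx
      have : 0 < κ := by by_contra h; nlinarith
      nlinarith
  · have h4 := hrmin' _ (hX i hi) h1
    have h5 : (f z - f (g j)) * (X i - g j) - (Y i - f (g j)) * (z - g j) ≤ 0 := by
      by_contra h5
      exact hclear i hi (Or.inr ⟨by linarith, h2, not_le.1 h5⟩)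
    rcases hκ with ⟨-, h6⟩ | ⟨h6, h7⟩
    · linarith
    rw [h6] at h5
    rw [h7] at h3
    rcases lt_or_gt_of_ne hρx with hρx | hρx
    · have := hlmax' ρ hρ hρx
      have : 0 < κ := by by_contra h; nlinarith
      nlinarith
    · have := hrmin' ρ hρ hρx
      have : κ < 0 := by by_contra h; nlinarith
      nlinarith

end ChainGuard

namespace RealRAM

attribute [local simp] runOps Instr.run State.setNat State.setReal State.setNatArr State.setRealArr
  Function.update_apply Cond.Holds

variable {s s' : State} {τ : ℕ}

/-! ### The three classes and the complete program -/

theorem Instance.rel_left {D : Instance} {j t : ℕ} :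
    D.Rel (1, 0, 0) j t ↔ D.gx j < D.tx t ∧ D.Unobstructed j t := by
  rw [Instance.Rel, side]
  split_ifs <;> simp_all

theorem Instance.rel_middle {D : Instance} {j t : ℕ} :
    D.Rel (0, 1, 0) j t ↔ D.gx j = D.tx t ∧ D.Unobstructed j t := by
  rw [Instance.Rel, side]
  split_ifs with h h'
  · simp [h.ne]
  · simp [h'.ne']
  · simp [le_antisymm (not_lt.1 h') (not_lt.1 h)]

theorem Instance.rel_right {D : Instance} {j t : ℕ} :
    D.Rel (0, 0, 1) j t ↔ D.tx t < D.gx j ∧ D.Unobstructed j t := by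
  rw [Instance.Rel, side]
  split_ifs with h h'
  · simp [h.le]
  · simp [h']
  · simp [h']

theorem Instance.load_all {D : Instance} {f : ℕ → ℝ} {t : ℕ} :
    D.load (1, 1, 1) f t = D.load (1, 0, 0) f t + D.load (0, 1, 0) f t + D.load (0, 0, 1) f t := by
  simp only [Instance.load]
  rw [← Finset.sum_add_distrib, ← Finset.sum_add_distrib]
  refine Finset.sum_congr rfl fun j _ => ?_
  have h0 := D.rel_all (j := j) (t := t)
  have h1 := D.rel_left (j := j) (t := t)
  have h2 := D.rel_middle (j := j) (t := t)
  have h3 := D.rel_right (j := j) (t := t)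
  by_cases hu : D.Unobstructed j t
  · rcases lt_trichotomy (D.gx j) (D.tx t) with h | h | h
    · rw [if_pos (h0.2 hu), if_pos (h1.2 ⟨h, hu⟩), if_neg fun h' => h.ne (h2.1 h').1,
        if_neg fun h' => h.not_gt (h3.1 h').1, add_zero, add_zero]
    · rw [if_pos (h0.2 hu), if_pos (h2.2 ⟨h, hu⟩), if_neg fun h' => h.not_lt (h1.1 h').1,
        if_neg fun h' => h.not_gt (h3.1 h').1, zero_add, add_zero]
    · rw [if_pos (h0.2 hu), if_pos (h3.2 ⟨h, hu⟩), if_neg fun h' => h.not_gt (h1.1 h').1,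
        if_neg fun h' => h.ne' (h2.1 h').1, zero_add, zero_add]
  · rw [if_neg fun h' => hu (h0.1 h'), if_neg fun h' => hu (h1.1 h').2,
      if_neg fun h' => hu (h2.1 h').2, if_neg fun h' => hu (h3.1 h').2, add_zero, add_zero]

/-- The critical abscissas, the targets and the memory after the first phase. -/
structure Prepared (D : Instance) (S : Set ℝ) (s : State) : Prop where
  env : Env D s
  finite : S.Finite
  vertex : ∀ i < D.n, D.vx i ∈ S
  root : ∀ e < D.n - 1, ∀ j < D.m, ∀ i < D.n, rootX D.vx D.vy D.gx D.gy e j i ∈ S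
  first : ∃ t < D.M, D.tx t = D.vx 0 ∧ D.ty t = D.vy 0
  middle : ∀ e < D.n - 1, ∀ x ∈ S, ∀ y ∈ S, D.vx e ≤ (x + y) / 2 → (x + y) / 2 ≤ D.vx (e + 1) →
    ∃ t < D.M, D.tx t = (x + y) / 2 ∧ D.ty t = lineY D.vx D.vy e ((x + y) / 2)
  sound : ∀ t < D.M, D.tx t = D.vx 0 ∧ D.ty t = D.vy 0 ∨
    ∃ e < D.n - 1, D.vx e ≤ D.tx t ∧ D.tx t ≤ D.vx (e + 1) ∧ D.ty t = lineY D.vx D.vy e (D.tx t)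

/-- The first phase: computation of the targets. -/
def prepareP : Prog :=
  .seq (ops [.natConst 2 1, .natSub 6 0 2]) (.seq vertexP (.seq rootP targetP))

/-- The running time of `prepareP`. -/
def prepareT {R : Type*} [CommSemiring R] (B : R) : R :=
  2 + (forT B 3 + (rootT B + targetT B))

theorem runs_prepare {N : ℕ} (h3 : s.natVar 3 = 0) (h4 : s.natVar 4 = 0) (h5 : s.natVar 5 = 0)
    (hz : s.realVar 20 = 0) (hN : s.natVar 0 ≤ N) (hm : s.natVar 1 ≤ N)
    (hc : s.natVar 0 + (s.natVar 0 - 1) * (s.natVar 1 * s.natVar 0) ≤ N) :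
    Runs prepareP s (prepareT N) (fun s' => ∃ M tx ty S,
      Prepared ⟨s.natVar 0, s.natVar 1, M, s.realArr 0, s.realArr 1, s.realArr 2, s.realArr 3,
        tx, ty⟩ S s' ∧
      M ≤ 1 + (s.natVar 0 - 1) *
        ((s.natVar 0 + (s.natVar 0 - 1) * (s.natVar 1 * s.natVar 0)) *
          (s.natVar 0 + (s.natVar 0 - 1) * (s.natVar 1 * s.natVar 0)))) := by
  -- The targets are not known yet; the zeros are placeholders, to which `Base` does not refer.
  let D : Instance := ⟨s.natVar 0, s.natVar 1, 0, s.realArr 0, s.realArr 1, s.realArr 2,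
    s.realArr 3, 0, 0⟩
  refine (runs_ops (A := Base D) _ (by constructor <;> simp [h3, hz, D])).seq ?_
  intro s₁ hF₁ hE₁
  refine (runs_vertex hE₁ hN ((hF₁.nat 5 rfl).trans h5)).seq ?_
  intro s₂ hF₂ ⟨h5₂, hv⟩
  have hE₂ := hE₁.of_frame hF₂ rfl
  refine (runs_root hE₂ hN hm).seq ?_
  intro s₃ hF₃ ⟨h5₃, hv₃, hr⟩
  have hE₃ := hE₂.of_frame hF₃ rfl
  have h4₃ : s₃.natVar 4 = 0 := (hF₃.nat 4 rfl).trans ((hF₂.nat 4 rfl).trans ((hF₁.nat 4 rfl).trans h4))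
  have h5' : s₃.natVar 5 = s.natVar 0 + (s.natVar 0 - 1) * (s.natVar 1 * s.natVar 0) := by
    rw [h5₃, h5₂]
  refine (runs_target hE₃ hN (by rw [h5']; exact hc) h4₃).conseq ?_
  rintro s₄ hF₄ ⟨hM, hS, h0, hmid⟩
  have hE₄ := hE₃.of_frame hF₄ rfl
  rw [h5'] at hM
  refine ⟨s₄.natVar 4, s₄.realArr 4, s₄.realArr 5, {x | Crit s₃ x}, ⟨?_, ?_, ?_, ?_, ?_, ?_, ?_⟩,
    hM⟩
  · exact ⟨hE₄.n, hE₄.m, hE₄.one, hE₄.zero, rfl, hE₄.rzero, hE₄.vx, hE₄.vy, hE₄.gx, hE₄.gy, rfl,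
      rfl⟩
  · refine ((Finset.range (s₃.natVar 5)).image (s₃.realArr 6)).finite_toSet.subset ?_
    rintro x ⟨k, hk, rfl⟩
    simp only [Finset.coe_image, Set.mem_image, Finset.mem_coe, Finset.mem_range]
    exact ⟨k, hk, rfl⟩
  · exact fun i hi => hv₃ _ (hv i hi)
  · exact hr
  · exact h0
  · exact fun e he x hx y hy hl hr => hmid e he x y hx hy hl hr
  · exact fun t ht => hS _ _ ⟨t, ht, rfl, rfl⟩

/-- The approximation algorithm. -/
def guardP : Prog :=
  .branch (.natLt 3 0)
    (.seq prepareP (.seq weightsP (.seq (chooseP 1 0 0 1) (.seq (chooseP 0 1 0 1)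
      (chooseP 0 0 1 (-1)))))) .skip

/-- A bound on the number of rounds of every loop of `guardP` on inputs of size `N`. -/
def loopBound {R : Type*} [CommSemiring R] (N : R) : R :=
  1 + N * ((N + N * (N * N)) * (N + N * (N * N))) + (N + N * (N * N)) + N * (6 * N)

/-- The running time of `guardP` on inputs of size `N`. -/
def guardT {R : Type*} [CommSemiring R] (N : R) : R :=
  prepareT (loopBound N) + (weightsT (loopBound N) + (chooseT (loopBound N) +
    (chooseT (loopBound N) + chooseT (loopBound N)))) + 1

/-- The running times are defined over an arbitrary commutative semiring so that the same expression
gives both the polynomial and its values. -/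
theorem eval_guardT (N : ℕ) : (guardT (Polynomial.X : Polynomial ℕ)).eval N = guardT N := by
  simp [guardT, prepareT, weightsT, chooseT, loopBound, forT, rootT, targetT, stepT, argminT, loadT,
    seesT, activateT, roundT]

/-- What the second phase achieves on the instance `D`. -/
theorem runs_select {D : Instance} {N : ℕ} (h : Env D s) (hN : D.n ≤ N) (hm : D.m ≤ N)
    (hM : D.M ≤ N) (hM0 : 0 < D.M) (hN' : D.m * (6 * D.m) ≤ N)
    (h8 : ∀ j < D.m, s.realArr 8 j = 0) (h0 : ∀ j, s.natArr 0 j = 0)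
    (hD₁ : D.Crossing (1, 0, 0) 1) (hD₂ : D.Crossing (0, 1, 0) 1)
    (hD₃ : D.Crossing (0, 0, 1) (-1)) (hall : D.Hits (Finset.range D.m)) :
    Runs (.seq weightsP (.seq (chooseP 1 0 0 1) (.seq (chooseP 0 1 0 1) (chooseP 0 0 1 (-1))))) s
      (weightsT N + (chooseT N + (chooseT N + chooseT N))) (fun s' =>
      ∃ C : Finset ℕ, (∀ j, s'.natArr 0 j = 1 ↔ j ∈ C) ∧ D.Hits C ∧
        ∀ H, D.Hits H → C.card ≤ 18 * H.card) := by
  have hm0 : 0 < D.m := by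
    obtain ⟨j, hj, -⟩ := hall.2 0 hM0
    exact (Nat.zero_le j).trans_lt (Finset.mem_range.1 hj)
  refine (runs_weights h hN hm hM hM0 hm0 hN' h8).seq ?_
  rintro s₁ hF₁ ⟨w, S, hW⟩
  have hE₁ := h.of_frame hF₁ rfl
  have ho₁ := hF₁.natArr 0 rfl
  -- `θ` is a third of the least load; the algorithm never computes it. Applied to `p`,
  -- `Instance.Weights.le_load` gives `6 * m ^ 2 ≤ 2 * |H| * (3 * θ)`, and applying this to the set
  -- of all guards shows `θ > 0`.
  obtain ⟨p, hp, hmin⟩ := Finset.exists_min_image (Finset.range D.M)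
    (D.load (1, 1, 1) (s₁.realArr 8)) ⟨0, Finset.mem_range.2 hM0⟩
  rw [Finset.mem_range] at hp
  obtain ⟨θ, hθ⟩ : ∃ θ, D.load (1, 1, 1) (s₁.realArr 8) p = 3 * θ :=
    ⟨D.load (1, 1, 1) (s₁.realArr 8) p / 3, by ring⟩
  have hopt : ∀ H, D.Hits H → ((D.m * (6 * D.m) : ℕ) : ℝ) ≤ 6 * H.card * θ := fun H hH => by
    have := hW.le_load hm0 hH hp
    rw [hθ] at this
    linarith
  have hpos : (0 : ℝ) < ((D.m * (6 * D.m) : ℕ) : ℝ) := by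
    have : 0 < D.m * (6 * D.m) := by positivity
    exact_mod_cast this
  have hθ0 : 0 < θ := by
    have := hopt _ hall
    by_contra hneg
    have : 6 * ((Finset.range D.m).card : ℝ) * θ ≤ 0 :=
      mul_nonpos_of_nonneg_of_nonpos (by positivity) (not_lt.1 hneg)
    linarith
  have hl : ∀ t < D.M, 3 * θ ≤ D.load (1, 1, 1) (s₁.realArr 8) t := fun t ht => by
    rw [← hθ]; exact hmin t (Finset.mem_range.2 ht)
  generalize hX : s₁.realArr 8 = X at *
  refine (runs_choose hE₁ hN hm hM (by simpa using hD₁) (by rw [hX]; exact hW.nonneg) hθ0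
    (by rw [hX]; exact hl)).seq ?_
  rintro s₂ hF₂ ⟨C₁, hs₁, ha₁, hc₁, hu₁⟩
  have hE₂ := hE₁.of_frame hF₂ rfl
  have hX₂ := (hF₂.realArr 8 rfl).trans hX
  refine (runs_choose hE₂ hN hm hM (by simpa using hD₂) (by rw [hX₂]; exact hW.nonneg) hθ0
    (by rw [hX₂]; exact hl)).seq ?_
  rintro s₃ hF₃ ⟨C₂, hs₂, ha₂, hc₂, hu₂⟩
  have hE₃ := hE₂.of_frame hF₃ rfl
  have hX₃ := (hF₃.realArr 8 rfl).trans hX₂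
  refine (runs_choose hE₃ hN hm hM (by simpa using hD₃) (by rw [hX₃]; exact hW.nonneg) hθ0
    (by rw [hX₃]; exact hl)).conseq ?_
  rintro s₄ hF₄ ⟨C₃, hs₃, ha₃, hc₃, hu₃⟩
  rw [hX] at hc₁ hu₁
  rw [hX₂] at hc₂ hu₂
  rw [hX₃] at hc₃ hu₃
  rw [hW.sum_avg] at hc₁ hc₂ hc₃
  refine ⟨C₁ ∪ C₂ ∪ C₃, fun j => ?_, ⟨Finset.union_subset (Finset.union_subset hs₁ hs₂) hs₃,
    fun t ht => ?_⟩, fun H hH => ?_⟩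
  · rw [ha₃, ha₂, ha₁, ho₁, h0, Finset.mem_union, Finset.mem_union]
    simp
  · have hsum := D.load_all (f := X) (t := t)
    by_cases h1 : D.load (1, 1, 1) X t ≤ 3 * D.load (1, 0, 0) X t
    · obtain ⟨j, hj, hjt⟩ := hu₁ t ht h1
      exact ⟨j, by simp [hj], hjt⟩
    by_cases h2 : D.load (1, 1, 1) X t ≤ 3 * D.load (0, 1, 0) X t
    · obtain ⟨j, hj, hjt⟩ := hu₂ t ht h2
      exact ⟨j, by simp [hj], hjt⟩
    -- The three classes share the whole load, so if the first two carry less than a third each, the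
    -- last one carries at least a third.
    obtain ⟨j, hj, hjt⟩ := hu₃ t ht (by linarith)
    exact ⟨j, by simp [hj], hjt⟩
  · have hle : ∀ C : Finset ℕ, C.card * θ ≤ ((D.m * (6 * D.m) : ℕ) : ℝ) →
        C.card ≤ 6 * H.card := fun C hC => by
      have : (C.card : ℝ) ≤ 6 * H.card := le_of_mul_le_mul_right (hC.trans (hopt H hH)) hθ0
      exact_mod_cast this
    have h1 := hle C₁ hc₁
    have h2 := hle C₂ hc₂
    have h3 := hle C₃ hc₃
    have h4 := Finset.card_union_le C₁ C₂
    have h5 := Finset.card_union_le (C₁ ∪ C₂) C₃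
    omega

end RealRAM

namespace ChainGuard
open RealRAM

/-! ### Transfer between instances and chains, and the conclusion -/

/-- The guards and the targets of `D` lie on the graph of `f`. -/
structure OnGraph (D : Instance) (f : ℝ → ℝ) : Prop where
  height : IsHeight D.n D.vx D.vy f
  guard_mem : ∀ j < D.m, D.vx 0 ≤ D.gx j ∧ D.gx j ≤ D.vx (D.n - 1)
  guard : ∀ j < D.m, D.gy j = f (D.gx j)
  target_mem : ∀ t < D.M, D.vx 0 ≤ D.tx t ∧ D.tx t ≤ D.vx (D.n - 1)
  target : ∀ t < D.M, D.ty t = f (D.tx t)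

theorem OnGraph.unobstructed_iff {D : Instance} {f : ℝ → ℝ} (h : OnGraph D f) {j t : ℕ}
    (hj : j < D.m) (ht : t < D.M) :
    D.Unobstructed j t ↔ Clear D.n D.vx D.vy f (D.gx j) (D.tx t) := by
  simp only [Instance.Unobstructed, Instance.Hides, Instance.cross, Clear, h.guard j hj,
    h.target t ht]

/-- The order claim with `q ≤ j < t ≤ t'` in terms of abscissas. -/
theorem OnGraph.crossing_left {D : Instance} {f : ℝ → ℝ} (h : OnGraph D f) :
    D.Crossing (1, 0, 0) 1 := by
  intro j q t t' hq hj ht ht'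
  simp only [Instance.rel_left, h.unobstructed_iff hj ht, h.unobstructed_iff hj ht',
    h.unobstructed_iff hq ht, h.unobstructed_iff hq ht', mul_one]
  rintro ⟨h1, h2⟩ ⟨h3, h4⟩ h5 ⟨h6, h7⟩ h8
  exact ⟨h6.trans_le h5, h7.cross h.height (h.guard_mem q hq).1 h8 h1 h5 (h.target_mem t' ht').2 h4⟩

/-- Degenerate: a guard of this class has the abscissa of its targets, so `t`, `t'`, `j` and `q`
share one abscissa. -/
theorem OnGraph.crossing_middle {D : Instance} {f : ℝ → ℝ} (h : OnGraph D f) :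
    D.Crossing (0, 1, 0) 1 := by
  intro j q t t' hq hj ht ht'
  simp only [Instance.rel_middle, h.unobstructed_iff hj ht, h.unobstructed_iff hj ht',
    h.unobstructed_iff hq ht, h.unobstructed_iff hq ht', mul_one]
  rintro ⟨h1, h2⟩ ⟨h3, h4⟩ h5 ⟨h6, h7⟩ h8
  rw [h6, ← h1, h3]
  exact ⟨rfl, by rwa [h3] at h4⟩

/-- The mirror image: here `t' ≤ t < j ≤ q`, and the order claim is applied with the targets on the
left, by the symmetry of visibility. -/
theorem OnGraph.crossing_right {D : Instance} {f : ℝ → ℝ} (h : OnGraph D f) :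
    D.Crossing (0, 0, 1) (-1) := by
  intro j q t t' hq hj ht ht'
  simp only [Instance.rel_right, h.unobstructed_iff hj ht, h.unobstructed_iff hj ht',
    h.unobstructed_iff hq ht, h.unobstructed_iff hq ht', mul_neg, mul_one, neg_le_neg_iff]
  rintro ⟨h1, h2⟩ ⟨h3, h4⟩ h5 ⟨h6, h7⟩ h8
  exact ⟨h3.trans_le h8, clear_comm ((clear_comm h4).cross h.height (h.target_mem t' ht').1 h5 h1 h8
    (h.guard_mem q hq).2 (clear_comm h7))⟩

section chain

variable {n m : ℕ} {v : Fin n → ℝ × ℝ} {f : ℝ → ℝ}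

theorem extend_apply {n : ℕ} (f : Fin n → ℝ) (i : Fin n) : extend f i = f i := by
  simp [extend]

theorem mem_chain_iff (hn : 0 < n)
    (hf : IsHeight n (extend fun i => (v i).1) (extend fun i => (v i).2) f) {p : ℝ × ℝ} :
    p ∈ chain v ↔ extend (fun i => (v i).1) 0 ≤ p.1 ∧ p.1 ≤ extend (fun i => (v i).1) (n - 1) ∧
      p.2 = f p.1 := by
  set X := extend fun i => (v i).1 with hX
  set Y := extend fun i => (v i).2 with hY
  have hXi : ∀ i : Fin n, (v i).1 = X i := fun i => (extend_apply (fun i => (v i).1) i).symm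
  have hYi : ∀ i : Fin n, (v i).2 = Y i := fun i => (extend_apply (fun i => (v i).2) i).symm
  have hmono : ∀ i k, i ≤ k → k ≤ n - 1 → X i ≤ X k := fun i k hik hk =>
    le_of_lt_succ (fun e he => hf.lt e (by omega)) hik
  have hv : ∀ i : Fin n, v i = (X i, Y i) := fun i => Prod.ext (hXi i) (hYi i)
  constructor
  · rintro (⟨i, rfl⟩ | ⟨i, j, hij, a, b, ha, hb, hab, rfl⟩)
    · have hi := i.2
      rw [hv]
      exact ⟨hmono _ _ (Nat.zero_le _) (by omega), hmono _ _ (by omega) le_rfl,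
        (hf.vertex i hi).symm⟩
    · have hj := j.2
      have hi : (i : ℕ) < n - 1 := by omega
      have hlt := hf.lt i hi
      rw [hv i, hv j, ← hij]
      have hl : X i ≤ a * X i + b * X (i + 1) := by
        have := mul_le_mul_of_nonneg_left hlt.le hb
        have h1 : a * X i + b * X i = X i := by rw [← add_mul, hab, one_mul]
        linarith
      have hr : a * X i + b * X (i + 1) ≤ X (i + 1) := by
        have := mul_le_mul_of_nonneg_left hlt.le ha
        have h1 : a * X (i + 1) + b * X (i + 1) = X (i + 1) := by rw [← add_mul, hab, one_mul]
        linarith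
      simp only [Prod.smul_mk, Prod.mk_add_mk, smul_eq_mul]
      refine ⟨(hmono 0 i (Nat.zero_le _) (by omega)).trans hl,
        hr.trans (hmono _ _ (by omega) le_rfl), ?_⟩
      rw [hf.edge i hi _ hl hr, lineY]
      have hw : X (i + 1) - X i ≠ 0 := (sub_pos.2 hlt).ne'
      obtain rfl : a = 1 - b := by linarith
      field_simp
      ring
  · rintro ⟨h0, h1, h2⟩
    rcases Nat.eq_zero_or_pos (n - 1) with hn1 | hn1
    · rw [hn1] at h1
      refine Or.inl ⟨⟨0, hn⟩, ?_⟩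
      rw [hv]
      have h3 := le_antisymm h1 h0
      refine Prod.ext h3.symm ?_
      rw [h2, h3]
      exact (hf.vertex 0 hn).symm
    · obtain ⟨e, he, hl, hr⟩ := exists_edge hn1 h0 h1
      have hlt := hf.lt e he
      have hw := sub_pos.2 hlt
      refine Or.inr ⟨⟨e, by omega⟩, ⟨e + 1, by omega⟩, rfl, (X (e + 1) - p.1) / (X (e + 1) - X e),
        (p.1 - X e) / (X (e + 1) - X e), div_nonneg (by linarith) hw.le,
        div_nonneg (by linarith) hw.le, by rw [← add_div]; exact div_eq_one_iff_eq hw.ne' |>.2 (by ring),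
        ?_⟩
      rw [hv, hv]
      have hw' := hw.ne'
      refine Prod.ext ?_ ?_
      · simp only [Prod.smul_mk, Prod.mk_add_mk, smul_eq_mul]
        field_simp
        ring
      · rw [h2, hf.edge e he _ hl hr, lineY]
        simp only [Prod.smul_mk, Prod.mk_add_mk, smul_eq_mul]
        field_simp
        ring

theorem sees_comm {g p : ℝ × ℝ} : Sees v g p ↔ Sees v p g := by
  rw [Sees, Sees, segment_symm]

/-- Both ends may lie above the chain: raising an end raises the whole segment, which is already on
or above the graph when it joins the graph points below. The case `g.1 = p.1` is a vertical segment.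
-/
theorem sees_of_belowChord (hn : 0 < n)
    (hf : IsHeight n (extend fun i => (v i).1) (extend fun i => (v i).2) f) {g p : ℝ × ℝ}
    (hle : g.1 ≤ p.1) (hg : f g.1 ≤ g.2) (hp : f p.1 ≤ p.2)
    (h : g.1 < p.1 → BelowChord f g.1 p.1) : Sees v g p := by
  refine Set.disjoint_left.2 ?_
  rintro z ⟨a, b, ha, hb, hab, rfl⟩ ⟨q, hq, hq1, hq2⟩
  rw [mem_chain_iff hn hf] at hq
  simp only [Prod.fst_add, Prod.snd_add, Prod.smul_fst, Prod.smul_snd, smul_eq_mul] at hq1 hq2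
  obtain rfl : a = 1 - b := by linarith
  rw [hq.2.2] at hq2
  have h1 := mul_le_mul_of_nonneg_left hg ha
  have h2 := mul_le_mul_of_nonneg_left hp hb
  rcases hle.eq_or_lt with heq | hlt
  · have : q.1 = p.1 := by rw [hq1, heq]; ring
    rw [this] at hq2
    rw [heq] at h1
    linarith
  · have hx : q.1 - g.1 = b * (p.1 - g.1) := by rw [hq1]; ring
    have h3 := h hlt q.1 (by nlinarith) (by nlinarith)
    rw [hx] at h3
    have h4 : f q.1 - f g.1 ≤ (f p.1 - f g.1) * b := by
      refine le_of_mul_le_mul_right ?_ (sub_pos.2 hlt)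
      linarith
    linarith

theorem sees_of_clear (hn : 0 < n)
    (hf : IsHeight n (extend fun i => (v i).1) (extend fun i => (v i).2) f) {g p : ℝ × ℝ}
    (hg : g ∈ chain v) (hp0 : extend (fun i => (v i).1) 0 ≤ p.1)
    (hp1 : p.1 ≤ extend (fun i => (v i).1) (n - 1)) (hp : f p.1 ≤ p.2)
    (h : Clear n (extend fun i => (v i).1) (extend fun i => (v i).2) f g.1 p.1) :
    Sees v g p := by
  obtain ⟨hg0, hg1, hg⟩ := (mem_chain_iff hn hf).1 hg
  rcases le_total g.1 p.1 with hle | hle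
  · exact sees_of_belowChord hn hf hle hg.ge hp
      fun hlt => (clear_iff_belowChord hf hlt hg0 hp1).1 h
  · exact sees_comm.1 (sees_of_belowChord hn hf hle hp hg.ge
      fun hlt => (clear_iff_belowChord hf hlt hp0 hg1).1 (clear_comm h))

/-- If the graph exceeded the chord at `x`, then the point of the chord at `x` would be strictly
below the chain. -/
theorem le_chord_of_sees (hn : 0 < n)
    (hf : IsHeight n (extend fun i => (v i).1) (extend fun i => (v i).2) f) {g p : ℝ × ℝ}
    (hg : g ∈ chain v) (hp : p ∈ chain v) (h : Sees v g p) (hlt : g.1 < p.1) :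
    BelowChord f g.1 p.1 := by
  obtain ⟨hg0, -, hg⟩ := (mem_chain_iff hn hf).1 hg
  obtain ⟨-, hp1, hp⟩ := (mem_chain_iff hn hf).1 hp
  intro x hl hr
  by_contra hx
  have hw := sub_pos.2 hlt
  have hw' := hw.ne'
  have hd := Set.disjoint_left.1 h
  refine hd (a := ((p.1 - x) / (p.1 - g.1)) • g + ((x - g.1) / (p.1 - g.1)) • p)
    ⟨_, _, div_nonneg (by linarith) hw.le, div_nonneg (by linarith) hw.le,
      by rw [← add_div]; exact div_eq_one_iff_eq hw' |>.2 (by ring), rfl⟩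
    ⟨(x, f x), (mem_chain_iff hn hf).2 ⟨hg0.trans hl, hr.trans hp1, rfl⟩, ?_, ?_⟩
  · simp only [Prod.fst_add, Prod.smul_fst, smul_eq_mul]
    field_simp
    ring
  · simp only [Prod.snd_add, Prod.smul_snd, smul_eq_mul]
    rw [hg, hp, div_mul_eq_mul_div, div_mul_eq_mul_div, ← add_div, div_lt_iff₀ hw]
    linarith

theorem clear_of_sees (hn : 0 < n)
    (hf : IsHeight n (extend fun i => (v i).1) (extend fun i => (v i).2) f) {g p : ℝ × ℝ}
    (hg : g ∈ chain v) (hp : p ∈ chain v) (h : Sees v g p) :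
    Clear n (extend fun i => (v i).1) (extend fun i => (v i).2) f g.1 p.1 := by
  have hg' := (mem_chain_iff hn hf).1 hg
  have hp' := (mem_chain_iff hn hf).1 hp
  rcases lt_trichotomy g.1 p.1 with hlt | heq | hlt
  · exact (clear_iff_belowChord hf hlt hg'.1 hp'.2.1).2 (le_chord_of_sees hn hf hg hp h hlt)
  · rintro i - (⟨h1, h2, -⟩ | ⟨h1, h2, -⟩) <;> linarith
  · exact clear_comm ((clear_iff_belowChord hf hlt hp'.1 hg'.2.1).2
      (le_chord_of_sees hn hf hp hg (sees_comm.1 h) hlt))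

/-- Reduction from the region to the chain: chain points belong to the region, and conversely a
guard that sees a chain point also sees every point vertically above it. -/
theorem guards_iff (hn : 0 < n)
    (hf : IsHeight n (extend fun i => (v i).1) (extend fun i => (v i).2) f)
    {g : Fin m → ℝ × ℝ} (hg : ∀ j, g j ∈ chain v) {H : Finset (Fin m)} :
    Guards v g H ↔ ∀ x, extend (fun i => (v i).1) 0 ≤ x → x ≤ extend (fun i => (v i).1) (n - 1) →
      ∃ j ∈ H, Clear n (extend fun i => (v i).1) (extend fun i => (v i).2) f (g j).1 x := by
  constructor
  · intro h x h0 h1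
    have hx : (x, f x) ∈ chain v := (mem_chain_iff hn hf).2 ⟨h0, h1, rfl⟩
    have := h (a := (x, f x)) ⟨_, hx, rfl, le_rfl⟩
    simp only [Set.mem_iUnion] at this
    obtain ⟨j, hj, hjx⟩ := this
    exact ⟨j, hj, clear_of_sees hn hf (hg j) hx hjx⟩
  · rintro h p ⟨q, hq, hq1, hq2⟩
    obtain ⟨h0, h1, h2⟩ := (mem_chain_iff hn hf).1 hq
    rw [hq1] at h0 h1 h2
    obtain ⟨j, hj, hjx⟩ := h p.1 h0 h1
    simp only [Set.mem_iUnion]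
    exact ⟨j, hj, sees_of_clear hn hf (hg j) h0 h1 (h2 ▸ hq2) hjx⟩

end chain

theorem le_of_eq_lineY {X Y : ℕ → ℝ} {f : ℝ → ℝ} {n : ℕ} (hf : IsHeight n X Y f) (hn : 0 < n)
    {x y : ℝ} (h : x = X 0 ∧ y = Y 0 ∨ ∃ e < n - 1, X e ≤ x ∧ x ≤ X (e + 1) ∧ y = lineY X Y e x) :
    X 0 ≤ x ∧ x ≤ X (n - 1) ∧ y = f x := by
  rcases h with ⟨rfl, rfl⟩ | ⟨e, he, hl, hr, rfl⟩
  · exact ⟨le_rfl, le_of_lt_succ hf.lt (Nat.zero_le _), (hf.vertex 0 hn).symm⟩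
  · exact ⟨(le_of_lt_succ (fun i hi => hf.lt i (by omega)) (Nat.zero_le e)).trans hl,
      hr.trans (le_of_lt_succ hf.lt he), (hf.edge e he x hl hr).symm⟩

theorem hits_map {n m : ℕ} {v : Fin n → ℝ × ℝ} {f : ℝ → ℝ} {g : Fin m → ℝ × ℝ} {D : Instance}
    (hn : 0 < n) (hf : IsHeight n (extend fun i => (v i).1) (extend fun i => (v i).2) f)
    (hg : ∀ j, g j ∈ chain v) (hD : OnGraph D f) (hDn : D.n = n) (hDm : D.m = m)
    (hDx : D.vx = extend fun i => (v i).1) (hDy : D.vy = extend fun i => (v i).2)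
    (hDg : D.gx = extend fun j => (g j).1) {H : Finset (Fin m)} (h : Guards v g H) :
    D.Hits (H.map Fin.valEmbedding) := by
  refine ⟨fun j hj => ?_, fun t ht => ?_⟩
  · obtain ⟨i, -, rfl⟩ := Finset.mem_map.1 hj
    rw [Finset.mem_range, hDm]
    exact i.2
  · obtain ⟨h0, h1⟩ := hD.target_mem t ht
    rw [hDx] at h0 h1
    rw [hDn] at h1
    obtain ⟨j, hj, hjt⟩ := (guards_iff hn hf hg).1 h _ h0 h1
    refine ⟨j, Finset.mem_map_of_mem _ hj, ?_⟩
    rw [hD.unobstructed_iff (hDm ▸ j.2) ht, hDn, hDx, hDy, hDg, extend_apply]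
    exact hjt

/-- The summands of `loopBound` account for the targets, the critical abscissas and the rounds of
the multiplicative-weights phase. -/
theorem loopBound_le {n m N : ℕ} (hN : n + m = N) :
    n ≤ loopBound N ∧ m ≤ loopBound N ∧ n + (n - 1) * (m * n) ≤ loopBound N ∧
      1 + (n - 1) * ((n + (n - 1) * (m * n)) * (n + (n - 1) * (m * n))) ≤ loopBound N ∧
      m * (6 * m) ≤ loopBound N := by
  have h1 : n ≤ N := by omega
  have h2 : m ≤ N := by omega
  have h3 : n - 1 ≤ N := by omega
  have h4 : n + (n - 1) * (m * n) ≤ N + N * (N * N) := by gcongr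
  have h5 : (n - 1) * ((n + (n - 1) * (m * n)) * (n + (n - 1) * (m * n))) ≤
    N * ((N + N * (N * N)) * (N + N * (N * N))) := by gcongr
  have h6 : m * (6 * m) ≤ N * (6 * N) := by gcongr
  simp only [loopBound]
  refine ⟨?_, ?_, ?_, ?_, ?_⟩ <;> nlinarith

theorem runs_guard (n m : ℕ) (v : Fin n → ℝ × ℝ) (g : Fin m → ℝ × ℝ)
    (hv : IsXMonotone v) (hg : ∀ j, g j ∈ chain v) (hG : Guards v g Finset.univ) :
    Runs guardP (input v g) (guardT (n + m)) (fun s => Guards v g (output m s) ∧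
      ∀ H : Finset (Fin m), Guards v g H → (output m s).card ≤ 18 * H.card) := by
  refine runs_branch (fun hn => ?_) (fun hn => ?_)
  swap
  -- The empty chain has nothing to see, and the untouched output array encodes the empty set.
  · obtain rfl : n = 0 := by simpa [Cond.Holds, input] using hn
    refine (runs_skip ⟨?_, fun H _ => ?_⟩).mono (Nat.zero_le _) (fun _ _ h => h)
    · rintro p ⟨q, ⟨i, -⟩ | ⟨i, -⟩, -⟩ <;> exact i.elim0
    · simp [output, input]
  replace hn : 0 < n := by simpa [Cond.Holds, input] using hn
  obtain ⟨b1, b2, b3, b4, b5⟩ := loopBound_le (n := n) (m := m) rfl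
  set X := extend fun i => (v i).1 with hX
  set Y := extend fun i => (v i).2 with hY
  have hlt : ∀ e < n - 1, X e < X (e + 1) := by
    intro e he
    have h1 := extend_apply (fun i => (v i).1) ⟨e, by omega⟩
    have h2 := extend_apply (fun i => (v i).1) ⟨e + 1, by omega⟩
    simp only at h1 h2
    rw [hX, h1, h2]
    exact hv (Fin.mk_lt_mk.2 (Nat.lt_succ_self e))
  obtain ⟨f, hf⟩ : ∃ f, IsHeight n X Y f := ⟨_, isHeight_height hlt⟩
  have hgx : ∀ j : Fin m, extend (fun j => (g j).1) j = (g j).1 := extend_apply _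
  have hgy : ∀ j : Fin m, extend (fun j => (g j).2) j = (g j).2 := extend_apply _
  refine (runs_prepare (s := input v g) rfl rfl rfl rfl b1 b2 b3).seq ?_
  rintro s₁ hF₁ ⟨M, tx, ty, S, hP, hM⟩
  change Prepared ⟨n, m, M, X, Y, extend fun j => (g j).1, extend fun j => (g j).2, tx, ty⟩ S s₁ at hP
  generalize hDD : Instance.mk n m M X Y (extend fun j => (g j).1) (extend fun j => (g j).2) tx ty
    = D at hP
  obtain ⟨hDn, hDm, hDM, hDx, hDy, hDgx, hDgy⟩ : D.n = n ∧ D.m = m ∧ D.M = M ∧ D.vx = X ∧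
    D.vy = Y ∧ D.gx = extend (fun j => (g j).1) ∧ D.gy = extend (fun j => (g j).2) := by
    rw [← hDD]; exact ⟨rfl, rfl, rfl, rfl, rfl, rfl, rfl⟩
  have hD : OnGraph D f := by
    refine ⟨by rw [hDn, hDx, hDy]; exact hf, fun j hj => ?_, fun j hj => ?_, fun t ht => ?_,
      fun t ht => ?_⟩
    · rw [hDm] at hj
      have := (mem_chain_iff hn hf).1 (hg ⟨j, hj⟩)
      rw [hDn, hDx, hDgx, hgx ⟨j, hj⟩]
      exact ⟨this.1, this.2.1⟩
    · rw [hDm] at hj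
      have := (mem_chain_iff hn hf).1 (hg ⟨j, hj⟩)
      rw [hDgx, hDgy, hgx ⟨j, hj⟩, hgy ⟨j, hj⟩]
      exact this.2.2
    · have hs := hP.sound t ht
      rw [hDn, hDx, hDy] at hs
      have := le_of_eq_lineY hf hn hs
      rw [hDn, hDx]
      exact ⟨this.1, this.2.1⟩
    · have hs := hP.sound t ht
      rw [hDn, hDx, hDy] at hs
      exact (le_of_eq_lineY hf hn hs).2.2
  have hhits : ∀ {H : Finset (Fin m)}, Guards v g H → D.Hits (H.map Fin.valEmbedding) := fun h =>
    hits_map hn hf hg hD hDn hDm hDx hDy hDgx h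
  have hall : D.Hits (Finset.range D.m) := by
    refine ⟨subset_rfl, fun t ht => ?_⟩
    obtain ⟨j, hj, hjt⟩ := (hhits hG).2 t ht
    exact ⟨j, (hhits hG).1 hj, hjt⟩
  have hM0 : 0 < D.M := by
    obtain ⟨t, ht, -⟩ := hP.first
    omega
  refine (runs_select (N := loopBound (n + m)) hP.env (hDn ▸ b1) (hDm ▸ b2)
    (hDM ▸ hM.trans b4) hM0 (hDm ▸ b5) (fun j _ => ?_) (fun j => ?_) hD.crossing_left
    hD.crossing_middle hD.crossing_right hall).conseq ?_
  -- The accumulator array `8` and the output array are never initialized by the program; that they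
  -- start at zero comes from the input memory.
  · rw [hF₁.realArr 8 rfl]; rfl
  · rw [hF₁.natArr 0 rfl]; rfl
  rintro s₂ - ⟨C, hC, hCH, hopt⟩
  have hmap : (output m s₂).map Fin.valEmbedding = C := by
    ext j
    simp only [output, Finset.mem_map, Finset.mem_filter, Finset.mem_univ, true_and,
      Fin.valEmbedding_apply, hC]
    refine ⟨?_, fun hj => ?_⟩
    · rintro ⟨i, hi, rfl⟩
      exact hi
    · have := Finset.mem_range.1 (hCH.1 hj)
      rw [hDm] at this
      exact ⟨⟨j, this⟩, hj, rfl⟩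
  -- The discretization is used in full only for `C`: seeing all targets implies seeing the chain.
  -- For a competitor `H` the trivial converse suffices, since the targets lie on the chain.
  refine ⟨(guards_iff hn hf hg).2 fun x h0 h1 => ?_, fun H hH => ?_⟩
  · have hclear : ∀ t < D.M, ∃ j ∈ C, Clear n X Y f (D.gx j) (D.tx t) := fun t ht => by
      obtain ⟨j, hj, hjt⟩ := hCH.2 t ht
      have := (hD.unobstructed_iff (Finset.mem_range.1 (hCH.1 hj)) ht).1 hjt
      rw [hDn, hDx, hDy] at this
      exact ⟨j, hj, this⟩
    obtain ⟨j, hj, hjx⟩ := exists_clear_of_middles (H := C) (g := D.gx) hf hP.finite hn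
      (by simpa only [hDn, hDx] using hP.vertex)
      (fun e he j hj i hi => by
        have hj' := Finset.mem_range.1 (hCH.1 hj)
        have := hP.root e (hDn ▸ he) j hj' i (hDn ▸ hi)
        rw [hDx, hDy] at this
        simpa only [rootX, hD.guard j hj'] using this)
      (by
        obtain ⟨t, ht, h1, -⟩ := hP.first
        rw [← hDx, ← h1, hDx]
        exact hclear t ht)
      (fun e he x hx y hy hl hr => by
        obtain ⟨t, ht, h1, -⟩ := hP.middle e (hDn ▸ he) x hx y hy (hDx ▸ hl) (hDx ▸ hr)
        rw [← h1]
        exact hclear t ht) h0 h1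
    rw [← hmap] at hj
    obtain ⟨i, hi, rfl⟩ := Finset.mem_map.1 hj
    refine ⟨i, hi, ?_⟩
    rw [hDgx] at hjx
    rw [← hgx i]
    exact hjx
  · have := hopt _ (hhits hH)
    rwa [← hmap, Finset.card_map, Finset.card_map] at this

end ChainGuard

theorem mainTheorem3 :
    ∃ (A : RealRAM.Prog) (K : ℕ) (T : Polynomial ℕ),
      ∀ (n m : ℕ) (v : Fin n → ℝ × ℝ) (g : Fin m → ℝ × ℝ),
        ChainGuard.IsXMonotone v →
        (∀ j, g j ∈ ChainGuard.chain v) →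
        ChainGuard.Guards v g Finset.univ →
        ∃ (s : RealRAM.State) (t : ℕ),
          RealRAM.Exec A (ChainGuard.input v g) s t ∧
          t ≤ T.eval (n + m) ∧
          ChainGuard.Guards v g (ChainGuard.output m s) ∧
          ∀ H : Finset (Fin m), ChainGuard.Guards v g H →
            (ChainGuard.output m s).card ≤ K * H.card := by
  refine ⟨RealRAM.guardP, 18, RealRAM.guardT Polynomial.X, fun n m v g hv hg hG => ?_⟩
  obtain ⟨s, t, he, ht, h1, h2⟩ := ChainGuard.runs_guard n m v g hv hg hG
  exact ⟨s, t, he, by rwa [RealRAM.eval_guardT], h1, h2⟩
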